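/- Let $d\ge 1$ and $m\ge 1$ be integers, let $c$ be an indeterminate, and let $\tilde f(z)=(z-c)z^d+c\in\mathbb Z[c][z]$. Write $\tilde f^{\circ k}$ for the $k$-th iterate of $\tilde f$ (with $\tilde f^{\circ 0}(z)=z$), let $\mu$ be the Möbius function, and put $\varepsilon_m=1$ if $m=1$ and $\varepsilon_m=0$ if $m\ne 1$. Let $$\tilde\Phi_m(z)=\prod_{k\mid m}\bigl(\tilde f^{\circ k}(z)-z\bigr)^{\mu(m/k)}$$ be the $m$-th dynatomic polynomial of $\tilde f$, and let an $m$-th multiplier polynomial of $\tilde f$ be a polynomial $\tilde\delta_m(x)\in\mathbb Z[c][x]$ with $$\tilde\delta_m(x)^m=\mathrm{Res}_z\bigl(\tilde\Phi_m(z),\,x-(\tilde f^{\circ m})'(z)\bigr).$$ Then $\tilde\Phi_m$ is indeed a polynomial in $\mathbb Z[c][z]$, its degree in $z$ is divisible by $d+1$, an $m$-th multiplier polynomial that is monic in $x$ exists, and for every $m$-th multiplier polynomial $\tilde\delta_m$ there is a polynomial $\Psi(x,C)\in\mathbb Z[x][C]$ such that $$d^{\,(d-1)\varepsilon_m+\deg_z\tilde\Phi_m/(d+1)}\,\tilde\delta_m(x)=\Psi\bigl(x,(dc)^d\bigr)$$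 and $\Psi$ or $-\Psi$ is monic as a polynomial in $C$ with coefficients in $\mathbb Z[x]$. In other words, $d^{(d-1)\varepsilon_m+\deg_z\tilde\Phi_m/(d+1)}\,\tilde\delta_m(x)$ lies in $\mathbb Z[(dc)^d,x]$ and is monic in $(dc)^d$ up to multiplication by $\pm1$. -/

import Mathlib

open Polynomial

noncomputable section

/-- `f^{∘k}(z)` for a polynomial `f(z)` over `R`, with `f^{∘0}(z) = z`. -/
def polyIterate {R : Type*} [CommRing R] (f : R[X]) (k : ℕ) : R[X] :=
  f.comp^[k] X

/-- The product `∏_{k ∣ m} (f^{∘k}(z) - z)^{μ(m/k)}`, with integer exponents, in the fraction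
field of the polynomial ring `R[z]`. -/
def dynatomicQuotient {R : Type*} [CommRing R] [IsDomain R] (f : R[X]) (m : ℕ) :
    FractionRing R[X] :=
  ∏ k ∈ m.divisors,
    (algebraMap R[X] (FractionRing R[X]) (polyIterate f k - X)) ^ ArithmeticFunction.moebius (m / k)

/-- `Φ` is the `m`-th dynatomic polynomial of `f`: the polynomial in `R[z]` whose image in the
fraction field of `R[z]` is `∏_{k ∣ m} (f^{∘k}(z) - z)^{μ(m/k)}` (there is at most one). -/
def IsDynatomicPolynomial {R : Type*} [CommRing R] [IsDomain R] (f : R[X]) (m : ℕ) (Φ : R[X]) :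
    Prop :=
  algebraMap R[X] (FractionRing R[X]) Φ = dynatomicQuotient f m

/-- `Res_z (Φ(z), x - (f^{∘m})'(z))`, an element of `R[x]`. The resultant is that of two
polynomials in `z` over `R[x]`; the inner variable is `x`, the outer one is `z`. -/
def multiplierResultant {R : Type*} [CommRing R] (f : R[X]) (m : ℕ) (Φ : R[X]) : R[X] :=
  resultant (Φ.map (C : R →+* R[X])) (C X - (derivative (polyIterate f m)).map (C : R →+* R[X]))

/-- `δ(x)` is an `m`-th multiplier polynomial of `f`, where `Φ` is the `m`-th dynatomic polynomial
of `f`: `δ(x)^m = Res_z (Φ(z), x - (f^{∘m})'(z))`. -/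
def IsMultiplierPolynomial {R : Type*} [CommRing R] (f : R[X]) (m : ℕ) (Φ δ : R[X]) : Prop :=
  δ ^ m = multiplierResultant f m Φ

/-- The family `(z - c) z^d + c` over `ℤ[c]`; the inner variable is `c`, the outer one is `z`. -/
def fTilde (d : ℕ) : ℤ[X][X] :=
  (X - C X) * X ^ d + C X

/-- `ε_m = 1` if `m = 1`, and `ε_m = 0` otherwise. -/
def epsilonOne (m : ℕ) : ℕ :=
  if m = 1 then 1 else 0

/-- For `Ψ(C)` a polynomial in `C` over `ℤ[x]`, the element `Ψ((d c)^d)` of `ℤ[c][x]`; the inner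
variable of the target is `c`, its outer one is `x`. -/
def evalAtScaledPower (d : ℕ) (Ψ : ℤ[X][X]) : ℤ[X][X] :=
  Ψ.eval₂ (mapRingHom (C : ℤ →+* ℤ[X])) (C (((d : ℤ[X]) * X) ^ d))

end

/-! Over an algebraic closure `L` of `ℚ(c)`, the multiplier polynomial is the product of `x - λ`
over the `m`-cycles, `λ` being the multiplier of the cycle. Everything rests on the size of `λ` at
suitable valuations of `L`.

Since `f(z) - c = (z - c) z^d`, telescoping around a cycle other than the fixed point `c` gives `(∏
z_i)^d = 1`. As `f'(z) = z^(d-1) ((d+1) z - d c)`, only the factors `(d+1) z_i - d c` matter for the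
size of `λ`. If one were smaller than `d c`, then `z_i` would be so close to the critical point
`dc/(d+1)` that its orbit escapes. Hence `|λ| ≥ |dc|^m` (`le_valuation_famMultiplier`): `|λ| > 1` at
the place `c = ∞`, and `|λ| ≥ 1` at the Gauss valuation of `ℤ[dc]` for each prime `p ∣ d`. In
particular `λ ≠ 1`, so `f^k(z) - z` has simple roots.

When all `|λ| ≥ 1`, the constant coefficient `±∏ λ` dominates the others. Its scaled value is a
Gauss unit: the product of `f'` over the roots of `f^k(z) - z` is found by evaluating at the
critical points `0` and `dc/(d+1)` (`exists_aeval_eq_prod_famDeriv`), and induction over divisors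
isolates exact periods. So the scaled coefficients lie in `ℤ[dc]`. Strict dominance at infinity
gives the constant coefficient the largest degree, with leading coefficient `±1`. Finally `c ↦ ωc`
with `ω^d = 1` replaces `f` by a conjugate map, so only powers of `(dc)^d` occur. -/

/-- The map `z ↦ (z - c) z^d + c` on a commutative ring. -/
def famMap {R : Type*} [CommRing R] (d : ℕ) (c z : R) : R := (z - c) * z ^ d + c

/-- The derivative of `famMap d c` at `z`, in factored form. -/
def famDeriv {R : Type*} [CommRing R] (d : ℕ) (c z : R) : R :=
  z ^ (d - 1) * ((d + 1) * z - d * c)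

/-- The derivative of the `m`-th iterate of `famMap d c` at `z`. -/
def famMultiplier {R : Type*} [CommRing R] (d : ℕ) (c : R) (m : ℕ) (z : R) : R :=
  ∏ i ∈ Finset.range m, famDeriv d c ((famMap d c)^[i] z)

/-- The polynomial `(z - c) z^d + c`. -/
noncomputable def famPoly {R : Type*} [CommRing R] (d : ℕ) (c : R) : R[X] :=
  (X - C c) * X ^ d + C c

/-! ### Iterates of the family and their derivatives. -/

section Basic

variable {R S : Type*} [CommRing R] [CommRing S]

theorem polyIterate_succ (f : R[X]) (k : ℕ) :
    polyIterate f (k + 1) = f.comp (polyIterate f k) := by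
  simp [polyIterate, Function.iterate_succ_apply']

theorem polyIterate_map (φ : R →+* S) (f : R[X]) (k : ℕ) :
    (polyIterate f k).map φ = polyIterate (f.map φ) k := by
  induction k with
  | zero => simp [polyIterate]
  | succ k ih => rw [polyIterate_succ, polyIterate_succ, Polynomial.map_comp, ih]

theorem eval_famPoly (d : ℕ) (c z : R) : (famPoly d c).eval z = famMap d c z := by
  simp [famPoly, famMap]

theorem eval_polyIterate_famPoly (d : ℕ) (c z : R) (k : ℕ) :
    (polyIterate (famPoly d c) k).eval z = (famMap d c)^[k] z := by
  induction k with
  | zero => simp [polyIterate]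
  | succ k ih =>
    rw [polyIterate_succ, eval_comp, ih, eval_famPoly, Function.iterate_succ_apply']

theorem eval_derivative_famPoly {d : ℕ} (hd : 0 < d) (c z : R) :
    (derivative (famPoly d c)).eval z = famDeriv d c z := by
  obtain ⟨e, rfl⟩ : ∃ e, d = e + 1 := ⟨d - 1, by omega⟩
  simp [famPoly, famDeriv, derivative_mul]
  ring

theorem eval_derivative_polyIterate {d : ℕ} (hd : 0 < d) (c z : R) (k : ℕ) :
    (derivative (polyIterate (famPoly d c) k)).eval z = famMultiplier d c k z := by
  induction k with
  | zero => simp [polyIterate, famMultiplier]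
  | succ k ih =>
    rw [polyIterate_succ, derivative_comp, eval_mul, ih, eval_comp, eval_polyIterate_famPoly,
      eval_derivative_famPoly hd, famMultiplier, famMultiplier, Finset.prod_range_succ, mul_comm]

theorem fTilde_eq_famPoly (d : ℕ) : fTilde d = famPoly d (X : ℤ[X]) := rfl

theorem famPoly_map (φ : R →+* S) (d : ℕ) (c : R) :
    (famPoly d c).map φ = famPoly d (φ c) := by
  simp [famPoly]

theorem famPoly_eq [Nontrivial R] (d : ℕ) (c : R) :
    (famPoly d c).Monic ∧ (famPoly d c).natDegree = d + 1 := by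
  have h1 : ((X - C c) * X ^ d : R[X]).Monic := (monic_X_sub_C c).mul (monic_X_pow d)
  have h2 : ((X - C c) * X ^ d : R[X]).natDegree = d + 1 := by
    rw [(monic_X_sub_C c).natDegree_mul (monic_X_pow d), natDegree_X_sub_C, natDegree_X_pow,
      add_comm]
  have h3 : (C c : R[X]).degree < ((X - C c) * X ^ d : R[X]).degree := by
    rw [degree_eq_natDegree h1.ne_zero, h2]
    exact degree_C_le.trans_lt (by exact_mod_cast Nat.succ_pos d)
  refine ⟨h1.add_of_left h3, ?_⟩
  rw [famPoly, natDegree_add_C, h2]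

theorem polyIterate_famPoly_eq [Nontrivial R] {d : ℕ} (hd : 0 < d) (c : R) (k : ℕ) :
    (polyIterate (famPoly d c) k).Monic ∧
      (polyIterate (famPoly d c) k).natDegree = (d + 1) ^ k := by
  induction k with
  | zero => simp [polyIterate, monic_X]
  | succ k ih =>
    obtain ⟨h1, h2⟩ := famPoly_eq d c
    rw [polyIterate_succ]
    refine ⟨h1.comp ih.1 (by rw [ih.2]; positivity), ?_⟩
    rw [natDegree_comp_eq_of_mul_ne_zero, ih.2, h2, pow_succ, mul_comm]
    rw [h1.leadingCoeff, ih.1.leadingCoeff]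
    simp

theorem monic_polyIterate_sub_X [Nontrivial R] {d : ℕ} (hd : 0 < d) (c : R) {k : ℕ} (hk : 0 < k) :
    (polyIterate (famPoly d c) k - X).Monic ∧
      (polyIterate (famPoly d c) k - X).natDegree = (d + 1) ^ k := by
  obtain ⟨h1, h2⟩ := polyIterate_famPoly_eq hd c k
  have h4 : 1 < (d + 1) ^ k := Nat.one_lt_pow hk.ne' (by omega)
  have h3 : (X : R[X]).natDegree < (polyIterate (famPoly d c) k).natDegree := by
    rw [h2, natDegree_X]; exact h4
  exact ⟨h1.sub_of_left (degree_lt_degree h3), by rw [natDegree_sub_eq_left_of_natDegree_lt h3, h2]⟩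

theorem famMap_zero_iterate {d : ℕ} (hd : 0 < d) (c : R) {k : ℕ} (hk : 0 < k) :
    (famMap d c)^[k] 0 = c := by
  have hc : famMap d c c = c := by simp [famMap]
  obtain ⟨e, rfl⟩ : ∃ e, k = e + 1 := ⟨k - 1, by omega⟩
  rw [Function.iterate_succ_apply]
  have : famMap d c 0 = c := by simp [famMap, hd.ne']
  rw [this, Function.iterate_fixed hc]

end Basic

/-! ### Periodic points and their number. -/

section Periodic

variable {L : Type*} [Field L] [DecidableEq L] (d : ℕ) (c : L)

/-- The set of fixed points of the `k`-th iterate of `famMap d c`. -/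
noncomputable def fixedSet (k : ℕ) : Finset L := (polyIterate (famPoly d c) k - X).roots.toFinset

/-- The set of points of exact period `k` of `famMap d c`. -/
noncomputable def perSet (k : ℕ) : Finset L :=
  (fixedSet d c k).filter fun z ↦ Function.minimalPeriod (famMap d c) z = k

variable {d c}

theorem mem_fixedSet (hd : 0 < d) {k : ℕ} (hk : 0 < k) {z : L} :
    z ∈ fixedSet d c k ↔ Function.IsPeriodicPt (famMap d c) k z := by
  rw [fixedSet, Multiset.mem_toFinset, mem_roots (monic_polyIterate_sub_X hd c hk).1.ne_zero,
    IsRoot.def, eval_sub, eval_polyIterate_famPoly, eval_X, sub_eq_zero]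
  rfl

theorem mem_perSet (hd : 0 < d) {k : ℕ} (hk : 0 < k) {z : L} :
    z ∈ perSet d c k ↔ Function.minimalPeriod (famMap d c) z = k := by
  rw [perSet, Finset.mem_filter, mem_fixedSet hd hk, and_iff_right_iff_imp]
  rintro rfl
  exact Function.isPeriodicPt_minimalPeriod _ _

theorem prod_fixedSet {M : Type*} [CommMonoid M] (hd : 0 < d) {k : ℕ} (hk : 0 < k) (h : L → M) :
    ∏ z ∈ fixedSet d c k, h z = ∏ e ∈ k.divisors, ∏ z ∈ perSet d c e, h z := by
  rw [← Finset.prod_biUnion]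
  · refine Finset.prod_congr ?_ fun _ _ ↦ rfl
    ext z
    rw [mem_fixedSet hd hk, Function.isPeriodicPt_iff_minimalPeriod_dvd, Finset.mem_biUnion]
    constructor
    · intro hz
      exact ⟨_, Nat.mem_divisors.2 ⟨hz, hk.ne'⟩, (mem_perSet hd (Nat.pos_of_dvd_of_pos hz hk)).2 rfl⟩
    · rintro ⟨e, he, hz⟩
      rw [(mem_perSet hd (Nat.pos_of_mem_divisors he)).1 hz]
      exact Nat.dvd_of_mem_divisors he
  · intro a ha b hb hab
    refine Finset.disjoint_left.2 fun z hza hzb ↦ hab ?_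
    rw [← (Finset.mem_filter.1 hza).2, ← (Finset.mem_filter.1 hzb).2]

/-- The derivative of `f^k(z) - z` at a root is the multiplier minus `1`, so no root is multiple. -/
theorem polyIterate_sub_X_eq_prod [IsAlgClosed L] (hd : 0 < d) {k : ℕ} (hk : 0 < k)
    (hsep : ∀ z, Function.IsPeriodicPt (famMap d c) k z → famMultiplier d c k z ≠ 1) :
    polyIterate (famPoly d c) k - X = ∏ z ∈ fixedSet d c k, (X - C z) := by
  obtain ⟨h1, -⟩ := monic_polyIterate_sub_X hd c hk
  have hnd : (polyIterate (famPoly d c) k - X).roots.Nodup := by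
    rw [Multiset.nodup_iff_count_le_one]
    intro z
    rw [count_roots]
    by_contra! hlt
    have hr : z ∈ (polyIterate (famPoly d c) k - X).roots := by
      rw [← Multiset.count_pos, count_roots]; omega
    have h2 := (one_lt_rootMultiplicity_iff_isRoot h1.ne_zero).1 hlt
    have h3 := h2.2
    rw [IsRoot.def, derivative_sub, derivative_X, eval_sub, eval_one,
      eval_derivative_polyIterate hd, sub_eq_zero] at h3
    exact hsep z ((mem_fixedSet hd hk).1 (Multiset.mem_toFinset.2 hr)) h3
  conv_lhs => rw [(IsAlgClosed.splits _).eq_prod_roots_of_monic h1]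
  rw [fixedSet, Finset.prod, Multiset.toFinset_val, hnd.dedup]

theorem card_fixedSet [IsAlgClosed L] (hd : 0 < d) {k : ℕ} (hk : 0 < k)
    (hsep : ∀ z, Function.IsPeriodicPt (famMap d c) k z → famMultiplier d c k z ≠ 1) :
    (fixedSet d c k).card = (d + 1) ^ k := by
  rw [← (monic_polyIterate_sub_X hd c hk).2, polyIterate_sub_X_eq_prod hd hk hsep,
    natDegree_prod_of_monic _ _ fun z _ ↦ monic_X_sub_C z]
  simp

theorem sum_card_perSet [IsAlgClosed L] (hd : 0 < d) {k : ℕ} (hk : 0 < k)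
    (hsep : ∀ z, Function.IsPeriodicPt (famMap d c) k z → famMultiplier d c k z ≠ 1) :
    ∑ e ∈ k.divisors, (perSet d c e).card = (d + 1) ^ k := by
  -- The constant `2` turns the product decomposition into an equality of powers of `2`, hence of
  -- exponents.
  have h := prod_fixedSet (c := c) hd hk fun _ ↦ 2
  simp only [Finset.prod_const, Finset.prod_pow_eq_pow_sum] at h
  rw [← Nat.pow_right_injective le_rfl h, card_fixedSet hd hk hsep]

/-- The counts over the divisors of `k` add up to `(d+1)^k`, and by induction those of proper
divisors are multiples of `d+1`. -/
theorem dvd_card_perSet [IsAlgClosed L] (hd : 0 < d) {k : ℕ} (hk : 0 < k)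
    (hsep : ∀ k, 0 < k → ∀ z, Function.IsPeriodicPt (famMap d c) k z →
      famMultiplier d c k z ≠ 1) : (d + 1) ∣ (perSet d c k).card := by
  induction k using Nat.strong_induction_on with
  | _ k ih =>
    have h := sum_card_perSet hd hk (hsep k hk)
    rw [← Nat.insert_self_properDivisors hk.ne', Finset.sum_insert Nat.self_notMem_properDivisors] at h
    refine (Nat.dvd_add_left (Finset.dvd_sum fun e he ↦ ?_)).1
      (h ▸ dvd_pow_self (d + 1) hk.ne')
    exact ih e (Nat.mem_properDivisors.1 he).2 (Nat.pos_of_mem_properDivisors he)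

end Periodic

/-- A finite set all of whose points have exact period `m` is a disjoint union of orbits. -/
theorem exists_orbit_representatives {α : Type*} [DecidableEq α] (f : α → α) {m : ℕ} (hm : 0 < m)
    (S : Finset α) (hS : ∀ z ∈ S, f z ∈ S) (hper : ∀ z ∈ S, Function.minimalPeriod f z = m) :
    ∃ T ⊆ S, ∀ {M : Type} [CommMonoid M] (h : α → M),
      ∏ z ∈ S, h z = ∏ z ∈ T, ∏ i ∈ Finset.range m, h (f^[i] z) := by
  induction S using Finset.strongInduction with
  | H S ih =>
    rcases S.eq_empty_or_nonempty with rfl | ⟨z, hz⟩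
    · exact ⟨∅, le_rfl, fun h ↦ by simp⟩
    · have hinj : Set.InjOn (fun i ↦ f^[i] z) (Finset.range m : Set ℕ) := by
        intro i hi j hj hij
        rw [Finset.coe_range, Set.mem_Iio, ← hper z hz] at hi hj
        exact (Function.iterate_eq_iterate_iff_of_lt_minimalPeriod hi hj).1 hij
      set O := (Finset.range m).image fun i ↦ f^[i] z with hO
      have hzm : f^[m] z = z := by
        rw [← hper z hz]; exact Function.isPeriodicPt_minimalPeriod _ _
      have hOS : O ⊆ S := by
        intro y hy
        obtain ⟨i, -, rfl⟩ := Finset.mem_image.1 hy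
        clear hy
        induction i with
        | zero => exact hz
        | succ i ih' => exact (Function.iterate_succ_apply' f i z).symm ▸ hS _ ih'
      have hzO : z ∈ O := Finset.mem_image.2 ⟨0, Finset.mem_range.2 hm, rfl⟩
      -- The complement of the orbit is again stable: a point `y` mapped into the orbit lies in it,
      -- because `y = f^[m-1] (f y)`.
      have hback : ∀ y ∈ S, f y ∈ O → y ∈ O := by
        intro y hy hfy
        obtain ⟨i, -, hi⟩ := Finset.mem_image.1 hfy
        have hy' : f^[m] y = y := by
          rw [← hper y hy]; exact Function.isPeriodicPt_minimalPeriod _ _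
        obtain ⟨e, rfl⟩ : ∃ e, m = e + 1 := ⟨m - 1, by omega⟩
        have hmod : y = f^[(e + i) % (e + 1)] z := by
          have h1 : f^[e + i] z = f^[(e + i) % (e + 1)] z := by
            have := Function.iterate_mod_minimalPeriod_eq (f := f) (x := z) (n := e + i)
            rw [hper z hz] at this
            exact this.symm
          rw [← h1, Function.iterate_add_apply]
          rw [hi, ← Function.iterate_succ_apply, hy']
        rw [hmod]
        exact Finset.mem_image.2 ⟨_, Finset.mem_range.2 (Nat.mod_lt _ hm), rfl⟩
      obtain ⟨T, hT, hprod⟩ := ih (S \ O)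
        (Finset.ssubset_iff_subset_ne.2 ⟨Finset.sdiff_subset, fun h ↦ by
          rw [← h] at hz; exact (Finset.mem_sdiff.1 hz).2 hzO⟩)
        (fun y hy ↦ by
          rw [Finset.mem_sdiff] at hy ⊢
          exact ⟨hS y hy.1, fun h ↦ hy.2 (hback y hy.1 h)⟩)
        (fun y hy ↦ hper y (Finset.mem_sdiff.1 hy).1)
      refine ⟨insert z T, Finset.insert_subset hz (hT.trans Finset.sdiff_subset), fun h ↦ ?_⟩
      rw [Finset.prod_insert fun h ↦ (Finset.mem_sdiff.1 (hT h)).2 hzO, ← hprod h,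
        ← Finset.prod_sdiff hOS, mul_comm, hO, Finset.prod_image hinj]

/-- A prime ideal of a subring of a field is the centre of some valuation ring of the field. -/
theorem exists_valuationSubring_of_prime {A L : Type*} [CommRing A] [Field L] (ψ : A →+* L)
    (hψ : Function.Injective ψ) (P : Ideal A) [P.IsPrime] :
    ∃ V : ValuationSubring L, ∀ a : A,
      V.valuation (ψ a) ≤ 1 ∧ (V.valuation (ψ a) < 1 ↔ a ∈ P) := by
  let e : A ≃+* ψ.range := RingEquiv.ofBijective ψ.rangeRestrict
    ⟨fun a b h ↦ hψ (congrArg Subtype.val h), ψ.rangeRestrict_surjective⟩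
  let P' : Ideal ψ.range := P.comap (e.symm : ψ.range →+* A)
  -- The localization at `P'` is dominated by a valuation ring, and domination keeps non-units
  -- non-units.
  obtain ⟨V, hle, hloc⟩ := (LocalSubring.ofPrime ψ.range P').exists_le_valuationSubring
  refine ⟨V, fun a ↦ ?_⟩
  have ha : ψ a ∈ (LocalSubring.ofPrime ψ.range P').toSubring :=
    LocalSubring.le_ofPrime _ _ ⟨a, rfl⟩
  have haV : ψ a ∈ V := hle ha
  refine ⟨(V.valuation_le_one_iff _).2 haV, ?_⟩
  have h3 := V.valuation_lt_one_iff ⟨ψ a, haV⟩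
  have h4 : IsUnit (⟨ψ a, haV⟩ : V) ↔
      IsUnit (⟨ψ a, ha⟩ : (LocalSubring.ofPrime ψ.range P').toSubring) :=
    ⟨fun h ↦ hloc.map_nonunit ⟨ψ a, ha⟩ h, fun h ↦ h.map (Subring.inclusion hle)⟩
  have h5 := IsLocalization.AtPrime.isUnit_to_map_iff
    (LocalSubring.ofPrime ψ.range P').toSubring P' (e a)
  refine h3.symm.trans ((IsLocalRing.mem_maximalIdeal _).trans ((not_congr (h4.trans h5)).trans ?_))
  simp [P', Ideal.primeCompl]

/-! ### Escaping orbits and lower bounds for multipliers. -/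

section Escape

variable {L Γ : Type*} [Field L] [LinearOrderedCommGroupWithZero Γ] {v : Valuation L Γ} {d : ℕ}
  {c z : L}

theorem famMap_sub (d : ℕ) (c z : L) : famMap d c z - c = (z - c) * z ^ d := by
  rw [famMap, add_sub_cancel_right]

/-- Beyond `v c` the map multiplies the size of `z` by `v z ^ d > 1`, so sizes grow strictly along
the orbit. -/
theorem not_isPeriodicPt_of_lt (hd : 0 < d) (hc : 1 < v c) (hz : v c < v z) {m : ℕ} (hm : 0 < m) :
    ¬ Function.IsPeriodicPt (famMap d c) m z := by
  have key : ∀ y, v c < v y → v y < v (famMap d c y) := by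
    intro y hy
    have h1 : 1 < v y := hc.trans hy
    have h2 : v ((y - c) * y ^ d) = v y * v y ^ d := by
      rw [map_mul, map_pow, v.map_sub_eq_of_lt_left hy]
    have h3 : v y < v y * v y ^ d :=
      lt_mul_of_one_lt_right (zero_lt_one.trans h1) (one_lt_pow₀ h1 hd.ne')
    rw [famMap, v.map_add_eq_of_lt_left (by rw [h2]; exact hy.trans h3), h2]
    exact h3
  have key2 : ∀ n, v z < v ((famMap d c)^[n + 1] z) := by
    intro n
    induction n with
    | zero => exact key z hz
    | succ n ih =>
      rw [Function.iterate_succ_apply']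
      exact ih.trans (key _ (hz.trans ih))
  intro h
  obtain ⟨n, rfl⟩ : ∃ n, m = n + 1 := ⟨m - 1, by omega⟩
  have := key2 n
  rw [h.eq] at this
  exact lt_irrefl _ this

/-- Otherwise `z` is so near the critical point that `f z` has the size of the critical value `c
((d+1)^(d+1) - (dc)^d) / (d+1)^(d+1)`. By `hgen` there is no cancellation in it, so this is at least
`v c`, and the next image exceeds `v c` and escapes. -/
theorem le_valuation_of_isPeriodicPt (hd : 0 < d) (hd1 : v ((d : L) + 1) = 1) (hdle : v (d : L) ≤ 1)
    (hc : 1 < v c) (hdc : 1 ≤ v (d * c))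
    (hgen : v (d * c) ^ d ≤ v (((d : L) + 1) ^ (d + 1) - (d * c) ^ d)) {m : ℕ} (hm : 0 < m)
    (hz : Function.IsPeriodicPt (famMap d c) m z) : v (d * c) ≤ v ((d + 1) * z - d * c) := by
  by_contra! hu
  set u := ((d : L) + 1) * z - d * c with hu_def
  have hdcc : v (d * c) ≤ v c := by
    rw [map_mul]; exact mul_le_of_le_one_left' hdle
  have hdc0 : 0 < v (d * c) := zero_lt_one.trans_le hdc
  have hc0 : 0 < v c := zero_lt_one.trans hc
  have hy : ((d : L) + 1) * z = d * c + u := by rw [hu_def]; ring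
  have hvy : v (((d : L) + 1) * z) = v (d * c) := by rw [hy, v.map_add_eq_of_lt_left hu]
  have hvz : v z = v (d * c) := by rw [← hvy, map_mul, hd1, one_mul]
  have hvzc : v (z - c) = v c := by
    have h : ((d : L) + 1) * (z - c) = u - c := by rw [hu_def]; ring
    rw [← v.map_sub_eq_of_lt_right (hu.trans_le hdcc), ← h, map_mul, hd1, one_mul]
  have hfz : v c ≤ v (famMap d c z) := by
    -- Expansion about the critical value; both correction terms are multiples of `u`.
    have h1 : ((d : L) + 1) ^ (d + 1) * famMap d c z =
        c * (((d : L) + 1) ^ (d + 1) - (d * c) ^ d) +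
          (u * (((d : L) + 1) * z) ^ d - c * ((((d : L) + 1) * z) ^ d - (d * c) ^ d)) := by
      rw [famMap, hu_def, mul_pow _ z]; ring
    have h2 : v (u * (((d : L) + 1) * z) ^ d) < v c * v (d * c) ^ d := by
      rw [map_mul, map_pow, hvy]
      exact mul_lt_mul_of_pos_right (hu.trans_le hdcc) (pow_pos hdc0 _)
    have h3 : v (c * ((((d : L) + 1) * z) ^ d - (d * c) ^ d)) < v c * v (d * c) ^ d := by
      rw [map_mul]
      refine mul_lt_mul_of_pos_left ?_ hc0
      have hsum : v (∑ i ∈ Finset.range d, (((d : L) + 1) * z) ^ i * (d * c) ^ (d - 1 - i)) ≤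
          v (d * c) ^ (d - 1) := by
        refine v.map_sum_le fun i hi ↦ ?_
        rw [Finset.mem_range] at hi
        rw [map_mul, map_pow, map_pow, hvy, ← pow_add]
        exact le_of_eq (congrArg _ (by omega))
      rw [← (Commute.all _ _).mul_geom_sum₂, map_mul]
      have h4 : ((d : L) + 1) * z - d * c = u := rfl
      rw [h4]
      calc v u * _ ≤ v u * v (d * c) ^ (d - 1) := mul_le_mul_of_nonneg_left hsum zero_le
        _ < v (d * c) * v (d * c) ^ (d - 1) := mul_lt_mul_of_pos_right hu (pow_pos hdc0 _)
        _ = v (d * c) ^ d := by rw [← pow_succ', Nat.sub_add_cancel hd]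
    have h5 : v c * v (d * c) ^ d ≤ v (c * (((d : L) + 1) ^ (d + 1) - (d * c) ^ d)) := by
      rw [v.map_mul c]; exact mul_le_mul_of_nonneg_left hgen zero_le
    have h6 : v (famMap d c z) = v (((d : L) + 1) ^ (d + 1) * famMap d c z) := by
      rw [map_mul, map_pow, hd1, one_pow, one_mul]
    rw [h6, h1, v.map_add_eq_of_lt_left ((v.map_sub_lt h2 h3).trans_le h5)]
    exact (le_mul_of_one_le_right' (one_le_pow₀ hdc)).trans h5
  have hffz : v c < v (famMap d c (famMap d c z)) := by
    have h1 : famMap d c (famMap d c z) = (z - c) * z ^ d * famMap d c z ^ d + c := by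
      rw [← famMap_sub]; rfl
    have h2 : v c < v ((z - c) * z ^ d * famMap d c z ^ d) := by
      rw [map_mul, map_mul, map_pow, map_pow, hvzc, hvz, mul_assoc]
      exact lt_mul_of_one_lt_right hc0 ((one_lt_pow₀ (hc.trans_le hfz) hd.ne').trans_le
        (le_mul_of_one_le_left' (one_le_pow₀ hdc)))
    rw [h1, v.map_add_eq_of_lt_left h2]
    exact h2
  exact not_isPeriodicPt_of_lt hd hc hffz hm (hz.apply_iterate 2)

theorem le_valuation_famMultiplier (hd : 0 < d) (hd1 : v ((d : L) + 1) = 1)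
    (hdle : v (d : L) ≤ 1) (hc : 1 < v c) (hdc : 1 ≤ v (d * c))
    (hgen : v (d * c) ^ d ≤ v (((d : L) + 1) ^ (d + 1) - (d * c) ^ d)) {m : ℕ} (hm : 0 < m)
    (hz : Function.IsPeriodicPt (famMap d c) m z) :
    v (d * c) ^ m ≤ v (famMultiplier d c m z) := by
  have hfix : famMap d c c = c := by simp [famMap]
  by_cases hzc : z = c
  · subst hzc
    have h1 : famDeriv d z z = z ^ d := by
      obtain ⟨e, rfl⟩ : ∃ e, d = e + 1 := ⟨d - 1, by omega⟩
      simp [famDeriv]; ring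
    have hdcc : v (d * z) ≤ v z := by
      rw [map_mul]; exact mul_le_of_le_one_left' hdle
    simp only [famMultiplier, Function.iterate_fixed hfix, h1, Finset.prod_const, Finset.card_range,
      map_pow]
    exact pow_le_pow_left₀ zero_le (hdcc.trans (le_self_pow₀ hc.le hd.ne')) m
  · have hne : ∏ i ∈ Finset.range m, ((famMap d c)^[i] z - c) ≠ 0 := by
      refine Finset.prod_ne_zero_iff.2 fun i hi h ↦ hzc ?_
      rw [sub_eq_zero] at h
      have h1 : (famMap d c)^[m - i + i] z = c := by
        rw [Function.iterate_add_apply, h, Function.iterate_fixed hfix]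
      rw [Nat.sub_add_cancel (Finset.mem_range.1 hi).le, hz.eq] at h1
      exact h1
    -- Multiply `f z - c = (z - c) z^d` around the cycle: the factors `z_i - c` on the two sides
    -- agree up to a cyclic shift and cancel.
    have hprod : (∏ i ∈ Finset.range m, (famMap d c)^[i] z) ^ d = 1 := by
      refine mul_left_cancel₀ hne ?_
      rw [mul_one, ← Finset.prod_pow, ← Finset.prod_mul_distrib]
      simp_rw [← famMap_sub, ← Function.iterate_succ_apply' (famMap d c)]
      have h1 := Finset.prod_range_succ (fun i ↦ (famMap d c)^[i] z - c) m
      rw [Finset.prod_range_succ', hz.eq] at h1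
      exact mul_right_cancel₀ (b := z - c) (sub_ne_zero.2 hzc) h1
    have hv : v (∏ i ∈ Finset.range m, (famMap d c)^[i] z) = 1 := by
      rw [← pow_eq_one_iff_of_nonneg zero_le hd.ne', ← map_pow, hprod, map_one]
    simp only [famMultiplier, famDeriv]
    rw [Finset.prod_mul_distrib, Finset.prod_pow, v.map_mul (_ ^ _), v.map_pow, hv, one_pow,
      one_mul, map_prod]
    refine le_of_eq_of_le (b := ∏ _i ∈ Finset.range m, v (d * c)) ?_ ?_
    · rw [Finset.prod_const, Finset.card_range]
    exact Finset.prod_le_prod' fun i _ ↦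
      le_valuation_of_isPeriodicPt hd hd1 hdle hc hdc hgen hm (hz.apply_iterate i)

end Escape

/-! ### Dominant coefficients and a Gauss-type integrality criterion. -/

section Gauss

variable {L Γ : Type*} [Field L] [LinearOrderedCommGroupWithZero Γ] (v : Valuation L Γ)

theorem coeff_X_sub_C_mul_succ {R : Type*} [CommRing R] (a : R) (q : R[X]) (j : ℕ) :
    ((X - C a) * q).coeff (j + 1) = q.coeff j - a * q.coeff (j + 1) := by
  rw [sub_mul, coeff_sub, coeff_X_mul, coeff_C_mul]

theorem coeff_X_sub_C_mul_zero {R : Type*} [CommRing R] (a : R) (q : R[X]) :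
    ((X - C a) * q).coeff 0 = -(a * q.coeff 0) := by
  simp [sub_mul]

theorem valuation_coeff_prod_le {ι : Type*} (T : Finset ι) (a : ι → L) (h : ∀ i ∈ T, 1 ≤ v (a i))
    (j : ℕ) : v ((∏ i ∈ T, (X - C (a i))).coeff j) ≤ v ((∏ i ∈ T, (X - C (a i))).coeff 0) := by
  classical
  induction T using Finset.induction generalizing j with
  | empty => rcases j with _ | j <;> simp [coeff_one]
  | insert i T hi ih =>
    rw [Finset.prod_insert hi]
    have h1 := h i (Finset.mem_insert_self _ _)
    have ih' := ih fun k hk ↦ h k (Finset.mem_insert_of_mem hk)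
    rcases j with _ | j
    · exact le_rfl
    · rw [coeff_X_sub_C_mul_succ, coeff_X_sub_C_mul_zero, v.map_neg, map_mul]
      refine v.map_sub_le ((ih' j).trans (le_mul_of_one_le_left' h1)) ?_
      rw [map_mul]
      gcongr
      exact ih' _

theorem valuation_coeff_prod_lt {ι : Type*} (T : Finset ι) (a : ι → L) (h : ∀ i ∈ T, 1 < v (a i))
    {j : ℕ} (hj : 0 < j) :
    v ((∏ i ∈ T, (X - C (a i))).coeff j) < v ((∏ i ∈ T, (X - C (a i))).coeff 0) := by
  classical
  induction T using Finset.induction generalizing j with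
  | empty => simp [coeff_one, hj.ne']
  | insert i T hi ih =>
    have h1 := h i (Finset.mem_insert_self _ _)
    have hT : ∀ k ∈ T, 1 < v (a k) := fun k hk ↦ h k (Finset.mem_insert_of_mem hk)
    have h0 : 0 < v ((∏ i ∈ T, (X - C (a i))).coeff 0) := zero_le.trans_lt (ih hT hj)
    rw [Finset.prod_insert hi]
    obtain ⟨j, rfl⟩ : ∃ k, j = k + 1 := ⟨j - 1, by omega⟩
    rw [coeff_X_sub_C_mul_succ, coeff_X_sub_C_mul_zero, v.map_neg, map_mul]
    refine v.map_sub_lt ?_ ?_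
    · exact (valuation_coeff_prod_le v T a (fun k hk ↦ (hT k hk).le) j).trans_lt
        (lt_mul_of_one_lt_left h0 h1)
    · rw [map_mul]
      exact mul_lt_mul_of_pos_left (ih hT hj) (zero_lt_one.trans h1)

theorem valuation_aeval_eq_pow (hint : ∀ n : ℤ, n ≠ 0 → v (n : L) = 1) {t : L} (ht : 1 < v t)
    {b : ℤ[X]} (hb : b ≠ 0) : v (aeval t b) = v t ^ b.natDegree := by
  have hlead : v (b.coeff b.natDegree • t ^ b.natDegree) = v t ^ b.natDegree := by
    rw [zsmul_eq_mul, map_mul, hint _ (by simpa using hb), one_mul, map_pow]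
  rw [aeval_eq_sum_range, ← hlead]
  refine v.map_sum_eq_of_lt (Finset.self_mem_range_succ _) fun i hi ↦ ?_
  rw [hlead]
  have hi' : i < b.natDegree := by
    rw [Finset.mem_sdiff, Finset.mem_range, Finset.mem_singleton] at hi; omega
  rw [zsmul_eq_mul, map_mul, map_pow]
  have h1 : v ((b.coeff i : ℤ) : L) ≤ 1 := by
    rcases eq_or_ne (b.coeff i) 0 with h | h
    · simp [h]
    · exact (hint _ h).le
  exact (mul_le_of_le_one_left' h1).trans_lt (pow_lt_pow_right₀ ht hi')

/-- An element of `ℤ[t, 1/D]` that is integral at the Gauss valuations of the primes dividing `D`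
lies in `ℤ[t]`. -/
theorem exists_eq_aeval_of_valuation_le_one {t y : L} [CharZero L] {D : ℕ} (hD : D ≠ 0)
    (hV : ∀ p : ℕ, p.Prime → p ∣ D → ∃ V : ValuationSubring L,
      (∀ n : ℕ, V.valuation (n : L) ≤ 1) ∧ V.valuation (p : L) < 1 ∧
      (∀ a : ℤ[X], V.valuation (aeval t a) < 1 → C (p : ℤ) ∣ a) ∧ V.valuation y ≤ 1)
    {b : ℤ[X]} (hb : D * y = aeval t b) : ∃ b' : ℤ[X], y = aeval t b' := by
  induction D using induction_on_primes generalizing b with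
  | zero => exact absurd rfl hD
  | one => exact ⟨b, by simpa using hb⟩
  | prime_mul p D hp ih =>
    obtain ⟨V, hn, hlt, hdvd, hy⟩ := hV p hp (dvd_mul_right _ _)
    -- Integrality of `y` at `V` forces `p ∣ b`, so one prime factor of the denominator cancels.
    obtain ⟨b', rfl⟩ := hdvd b (by
      rw [← hb, Nat.cast_mul, map_mul, map_mul, mul_assoc]
      exact mul_lt_one_of_lt_of_le hlt (mul_le_one' (hn D) hy))
    refine ih (right_ne_zero_of_mul hD) (fun q hq hqD ↦ hV q hq (hqD.mul_left _)) (b := b') ?_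
    have hp0 : (p : L) ≠ 0 := by exact_mod_cast hp.ne_zero
    refine mul_left_cancel₀ hp0 ?_
    rw [← mul_assoc, ← Nat.cast_mul, hb]
    simp

end Gauss

/-! ### The place at infinity and the Gauss valuations. -/

section Places

variable {L : Type*} [Field L] {c : L}

theorem transcendental_natCast_mul [CharZero L] (hc : Transcendental ℤ c) {d : ℕ} (hd : 0 < d) :
    Transcendental ℤ ((d : L) * c) := by
  intro h
  have hd0 : (d : L) ≠ 0 := by exact_mod_cast hd.ne'
  have h1 : IsAlgebraic ℤ ((d : L)⁻¹) := (isAlgebraic_natCast d).inv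
  exact hc (by simpa [hd0] using h1.mul h)

/-- The centre is the prime generated by `1/c` in `ℤ[1/c]`, which contains no nonzero integer. -/
theorem exists_valuation_infinity (hc : Transcendental ℤ c) :
    ∃ V : ValuationSubring L, (∀ n : ℤ, n ≠ 0 → V.valuation (n : L) = 1) ∧ 1 < V.valuation c := by
  have hc' : Transcendental ℤ c⁻¹ := fun h ↦ hc (by simpa using h.inv)
  have : (Ideal.span {(X : ℤ[X])}).IsPrime :=
    (Ideal.span_singleton_prime X_ne_zero).2 prime_X
  obtain ⟨V, hV⟩ := exists_valuationSubring_of_prime (aeval c⁻¹ : ℤ[X] →ₐ[ℤ] L).toRingHom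
    (transcendental_iff_injective.1 hc') (Ideal.span {X})
  refine ⟨V, fun n hn ↦ ?_, ?_⟩
  · have h := hV (C n)
    rw [Ideal.mem_span_singleton, X_dvd_iff, coeff_C_zero, iff_false_right hn, not_lt] at h
    simpa using le_antisymm h.1 h.2
  · have h := (hV X).2.2 (Ideal.mem_span_singleton_self X)
    simp only [AlgHom.toRingHom_eq_coe, RingHom.coe_coe, aeval_X, map_inv₀] at h
    have h0 : 0 < V.valuation c := by
      rw [zero_lt_iff, Ne, map_eq_zero]
      rintro rfl
      exact hc isAlgebraic_zero
    exact (inv_lt_one₀ h0).1 h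

theorem exists_valuation_prime {t : L} (ht : Transcendental ℤ t) {p : ℕ} (hp : p.Prime) :
    ∃ V : ValuationSubring L, ∀ a : ℤ[X],
      V.valuation (aeval t a) ≤ 1 ∧ (V.valuation (aeval t a) < 1 ↔ C (p : ℤ) ∣ a) := by
  have hp' : Prime (C (p : ℤ) : ℤ[X]) := prime_C_iff.2 (Nat.prime_iff_prime_int.1 hp)
  have : (Ideal.span {(C (p : ℤ) : ℤ[X])}).IsPrime :=
    (Ideal.span_singleton_prime hp'.ne_zero).2 hp'
  obtain ⟨V, hV⟩ := exists_valuationSubring_of_prime (aeval t : ℤ[X] →ₐ[ℤ] L).toRingHom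
    (transcendental_iff_injective.1 ht) (Ideal.span {C (p : ℤ)})
  refine ⟨V, fun a ↦ ?_⟩
  simpa [Ideal.mem_span_singleton] using hV a

theorem one_lt_valuation_famMultiplier {V : ValuationSubring L}
    (hV : ∀ n : ℤ, n ≠ 0 → V.valuation (n : L) = 1) (hVc : 1 < V.valuation c) {d : ℕ} (hd : 0 < d)
    {m : ℕ} (hm : 0 < m) {z : L} (hz : Function.IsPeriodicPt (famMap d c) m z) :
    1 < V.valuation (famMultiplier d c m z) := by
  have h1 : V.valuation (d : L) = 1 := by simpa using hV d (by exact_mod_cast hd.ne')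
  have h2 : V.valuation ((d : L) + 1) = 1 := by simpa using hV (d + 1) (by positivity)
  have h3 : V.valuation (d * c) = V.valuation c := by rw [map_mul, h1, one_mul]
  have h4 : 1 < V.valuation (d * c) := h3 ▸ hVc
  refine (one_lt_pow₀ h4 hm.ne').trans_le
    (le_valuation_famMultiplier hd h2 h1.le hVc h4.le ?_ hm hz)
  rw [Valuation.map_sub_eq_of_lt_right, map_pow]
  rw [map_pow, map_pow, h2, one_pow]
  exact one_lt_pow₀ h4 hd.ne'

theorem not_C_dvd_of_isUnit_leadingCoeff {p : ℕ} (hp : p.Prime) {a : ℤ[X]}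
    (ha : IsUnit a.leadingCoeff) : ¬ C (p : ℤ) ∣ a := fun h ↦
  (Nat.prime_iff_prime_int.1 hp).not_isUnit (isUnit_of_dvd_unit (C_dvd_iff_dvd_coeff _ _ |>.1 h _) ha)

/-- Here `d c` is a unit and `v d < 1`, so `v c > 1`. Cancellation in the critical value is excluded
because `(d+1)^(d+1) - X^d` has leading coefficient `-1` and so is nonzero modulo `p`. -/
theorem one_le_valuation_famMultiplier {d : ℕ} {p : ℕ} (hp : p.Prime) (hpd : p ∣ d)
    {V : ValuationSubring L} (hV : ∀ a : ℤ[X], V.valuation (aeval (d * c) a) ≤ 1 ∧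
      (V.valuation (aeval (d * c) a) < 1 ↔ C (p : ℤ) ∣ a)) (hd : 0 < d)
    {m : ℕ} (hm : 0 < m) {z : L} (hz : Function.IsPeriodicPt (famMap d c) m z) :
    1 ≤ V.valuation (famMultiplier d c m z) := by
  have hunit : ∀ a : ℤ[X], ¬ C (p : ℤ) ∣ a → V.valuation (aeval (d * c) a) = 1 := fun a ha ↦
    le_antisymm (hV a).1 (not_lt.1 fun h ↦ ha ((hV a).2.1 h))
  have h1 : V.valuation (d : L) < 1 := by
    have := (hV (C (d : ℤ))).2.2 (map_dvd C (by exact_mod_cast hpd))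
    simpa using this
  have h2 : V.valuation ((d : L) + 1) = 1 := by
    have := hunit (C ((d : ℤ) + 1)) (by
      rw [C_dvd_iff_dvd_coeff]
      intro h
      have h0 := h 0
      rw [coeff_C_zero] at h0
      have h3 : (p : ℤ) ∣ 1 := (dvd_add_right (by exact_mod_cast hpd)).1 h0
      exact (Nat.prime_iff_prime_int.1 hp).not_isUnit (isUnit_of_dvd_one h3))
    simpa using this
  have h3 : V.valuation (d * c) = 1 := by
    simpa using hunit X (not_C_dvd_of_isUnit_leadingCoeff hp (by simp))
  have h4 : 1 < V.valuation c := by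
    by_contra! h
    have : V.valuation (d * c) < 1 := by
      rw [map_mul]; exact mul_lt_one_of_lt_of_le h1 h
    exact this.ne h3
  refine (one_pow m).symm.trans_le (h3 ▸ le_valuation_famMultiplier hd h2 h1.le h4 h3.ge ?_ hm hz)
  have h5 := hunit (C (((d : ℤ) + 1) ^ (d + 1)) - X ^ d) (not_C_dvd_of_isUnit_leadingCoeff hp (by
    rw [← neg_sub, leadingCoeff_neg, leadingCoeff_X_pow_sub_C hd]; exact isUnit_one.neg))
  simp only [map_sub, aeval_C, map_pow, aeval_X] at h5
  rw [h3, one_pow]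
  refine le_of_eq (h5.symm.trans ?_)
  simp

end Places

/-! ### The critical orbit and products of derivatives. -/

section CriticalOrbit

theorem leadingCoeff_add_C_mul_X {R : Type*} [CommRing R] {g : R[X]} (hg : 1 < g.natDegree)
    (a : R) : (g + C a * X).natDegree = g.natDegree ∧
      (g + C a * X).leadingCoeff = g.leadingCoeff := by
  have h1 : (C a * X : R[X]).natDegree < g.natDegree :=
    ((natDegree_C_mul_le a X).trans natDegree_X_le).trans_lt hg
  exact ⟨natDegree_add_eq_left_of_natDegree_lt h1,
    leadingCoeff_add_of_degree_lt' (degree_lt_degree h1)⟩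

variable {L : Type*} [Field L] [CharZero L]

/-- Writing `c = (dc)/d`, the powers of `d` and `d+1` clear denominators, and both exponents grow by
the factor `d+1` at each further iteration. The terms coming from `c` are linear in `dc`, so they do
not affect the leading coefficient. -/
theorem exists_aeval_eq_iterate {d : ℕ} (hd : 0 < d) (c : L) (k : ℕ) :
    ∃ g : ℤ[X], IsUnit g.leadingCoeff ∧ g.natDegree = (d + 1) ^ (k + 1) ∧
      aeval (d * c) g = d ^ (d + 1) ^ k * (d + 1) ^ (d + 1) ^ (k + 1) *
        (famMap d c)^[k + 1] (d * c / (d + 1)) := by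
  have hd1 : (d : L) + 1 ≠ 0 := by exact_mod_cast d.succ_ne_zero
  induction k with
  | zero =>
    have hdeg : (-(X : ℤ[X]) ^ (d + 1)).natDegree = d + 1 := by simp
    obtain ⟨h1, h2⟩ := leadingCoeff_add_C_mul_X (g := -(X : ℤ[X]) ^ (d + 1)) (by omega)
      (((d : ℤ) + 1) ^ (d + 1))
    refine ⟨_, by rw [h2]; simp, by rw [h1, hdeg]; simp, ?_⟩
    simp [famMap, div_pow]
    field_simp
    ring
  | succ k ih =>
    obtain ⟨g, hu, hdeg, hg⟩ := ih
    set N := (d + 1) ^ (k + 1) with hN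
    have hN1 : 1 < N := Nat.one_lt_pow (by omega) (by omega)
    obtain ⟨n, hn⟩ : ∃ n, (d + 1) ^ k = n + 1 := ⟨(d + 1) ^ k - 1, by
      have : 0 < (d + 1) ^ k := by positivity
      omega⟩
    have hNn : N = (n + 1) * (d + 1) := by rw [hN, pow_succ, hn]
    obtain ⟨h1, h2⟩ := leadingCoeff_add_C_mul_X (g := g) (by omega)
      (-((d : ℤ) ^ n * (d + 1) ^ N))
    -- `q` is the scaled `w - c`; one of the `n + 1` factors `d` is absorbed into `X`, which stands
    -- for `dc`.
    set q := g + C (-((d : ℤ) ^ n * (d + 1) ^ N)) * X with hq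
    have hqdeg : (q * g ^ d).natDegree = N * (d + 1) := by
      rw [natDegree_mul', natDegree_pow, h1, hdeg]
      · ring
      · rw [leadingCoeff_pow, h2]
        exact (hu.mul (hu.pow d)).ne_zero
    obtain ⟨h3, h4⟩ := leadingCoeff_add_C_mul_X (g := q * g ^ d)
      (by rw [hqdeg]; nlinarith) ((d : ℤ) ^ (N - 1) * (d + 1) ^ (N * (d + 1)))
    refine ⟨_, ?_, h3.trans (hqdeg.trans (pow_succ _ _).symm), ?_⟩
    · rw [h4, leadingCoeff_mul, leadingCoeff_pow, h2]
      exact hu.mul (hu.pow d)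
    · rw [Function.iterate_succ_apply']
      set w := (famMap d c)^[k + 1] (d * c / (d + 1)) with hw
      have e1 : (d + 1) ^ (k + 1 + 1) = N * (d + 1) := pow_succ _ _
      have e2 : (d : L) ^ (N - 1) * d = d ^ N := by
        rw [← pow_succ, Nat.sub_add_cancel hN1.le]
      rw [e1, map_add, map_mul, map_pow, hg, hn, hq, map_add, hg, hn]
      simp only [map_mul, map_neg, map_pow, map_add, aeval_X, map_one, map_natCast,
        famMap]
      have e3 : (d : L) ^ N = d ^ ((n + 1) * d) * (d ^ n * d) := by
        rw [hNn, ← pow_succ, ← pow_add]; ring_nf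
      linear_combination (((d : L) + 1) ^ (N * (d + 1)) * c) * e2 -
        ((d : L) + 1) ^ (N * (d + 1)) * ((w - c) * w ^ d) * e3

/-- Evaluating `f^k(z) - z` at `0` gives `∏ z = ±c`, and at `dc/(d+1)` the product of the other
factors. The exponent `d - 1` turns `c^(d-1)` into `(dc)^(d-1)`; the rest clears the critical orbit.
-/
theorem exists_aeval_eq_prod_famDeriv [DecidableEq L] [IsAlgClosed L] {d : ℕ} (hd : 0 < d) (c : L)
    {k : ℕ} (hk : 0 < k)
    (hsep : ∀ z, Function.IsPeriodicPt (famMap d c) k z → famMultiplier d c k z ≠ 1) :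
    ∃ g : ℤ[X], IsUnit g.leadingCoeff ∧
      aeval (d * c) g = d ^ (d - 1 + (d + 1) ^ (k - 1)) * ∏ z ∈ fixedSet d c k, famDeriv d c z := by
  have hd1 : (d : L) + 1 ≠ 0 := by exact_mod_cast d.succ_ne_zero
  have hprod := polyIterate_sub_X_eq_prod hd hk hsep
  obtain ⟨j, rfl⟩ : ∃ j, k = j + 1 := ⟨k - 1, by omega⟩
  obtain ⟨g, hu, hdeg, hg⟩ := exists_aeval_eq_iterate hd c j
  have hN : 1 < (d + 1) ^ (j + 1) := Nat.one_lt_pow (by omega) (by omega)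
  have hcard := card_fixedSet hd hk hsep
  obtain ⟨-, h2⟩ := leadingCoeff_add_C_mul_X (g := g) (by omega)
    (-((d : ℤ) ^ (d + 1) ^ j * (d + 1) ^ ((d + 1) ^ (j + 1) - 1)))
  set N := (d + 1) ^ (j + 1)
  have h0 : ∏ z ∈ fixedSet d c (j + 1), z = (-1) ^ N * c := by
    have := congrArg (eval 0) hprod
    rw [eval_sub, eval_polyIterate_famPoly, famMap_zero_iterate hd c hk, eval_prod] at this
    simp only [eval_sub, eval_X, eval_C, zero_sub, sub_zero] at this
    rw [Finset.prod_neg, hcard] at this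
    refine Eq.symm ((congrArg _ this).trans ?_)
    rw [← mul_assoc, ← mul_pow]; simp
  have h1 : ∏ z ∈ fixedSet d c (j + 1), (((d : L) + 1) * z - d * c) =
      (-1) ^ N * (d + 1) ^ N * ((famMap d c)^[j + 1] (d * c / (d + 1)) - d * c / (d + 1)) := by
    have := congrArg (eval (d * c / (d + 1))) hprod
    rw [eval_sub, eval_polyIterate_famPoly, eval_prod] at this
    simp only [eval_sub, eval_X, eval_C] at this
    rw [this, ← mul_pow, ← hcard, ← Finset.prod_const, ← Finset.prod_mul_distrib]
    refine Finset.prod_congr rfl fun z _ ↦ ?_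
    field_simp
    ring
  refine ⟨C ((-1) ^ (N * (d - 1) + N)) * (X ^ (d - 1) *
    (g + C (-((d : ℤ) ^ (d + 1) ^ j * (d + 1) ^ (N - 1))) * X)), ?_, ?_⟩
  · rw [leadingCoeff_mul, leadingCoeff_mul, leadingCoeff_C, leadingCoeff_X_pow, one_mul, h2]
    exact ((isUnit_one.neg).pow _).mul hu
  · simp only [famDeriv]
    rw [Finset.prod_mul_distrib, Finset.prod_pow, h0, h1]
    simp only [map_mul, map_add, hg, map_neg, map_pow, aeval_X, map_one, map_natCast]
    have e1 : ((d : L) + 1) ^ N = (d + 1) ^ (N - 1) * (d + 1) := by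
      rw [← pow_succ, Nat.sub_add_cancel hN.le]
    have e2 : ((d : L) + 1) * (d * c / (d + 1)) = d * c := by field_simp
    generalize (famMap d c)^[j + 1] (d * c / (d + 1)) = y
    rw [Nat.add_sub_cancel]
    generalize hw : d * c / ((d : L) + 1) = w at *
    rw [e1]
    linear_combination ((-1) ^ (N * (d - 1) + N) * (d * c) ^ (d - 1) * d ^ (d + 1) ^ j *
      ((d : L) + 1) ^ (N - 1)) * e2

end CriticalOrbit

/-! ### Dynatomic polynomials and the multiplier resultant. -/

section Dynatomic

/-- The product of `f^{∘k}(z) - z` over the divisors `k` of `m` with `μ(m/k) = i`. -/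
noncomputable def moebiusPart {R : Type*} [CommRing R] (f : R[X]) (m : ℕ) (i : ℤ) : R[X] :=
  ∏ k ∈ m.divisors with ArithmeticFunction.moebius (m / k) = i, (polyIterate f k - X)

theorem moebiusPart_map {R S : Type*} [CommRing R] [CommRing S] (φ : R →+* S) (f : R[X]) (m : ℕ)
    (i : ℤ) : (moebiusPart f m i).map φ = moebiusPart (f.map φ) m i := by
  simp [moebiusPart, Polynomial.map_prod, polyIterate_map]

/-- The cross-multiplied identity has no fractions, so it passes along ring homomorphisms. -/
theorem isDynatomicPolynomial_iff {R : Type*} [CommRing R] [IsDomain R] {f : R[X]} {m : ℕ}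
    (hf : ∀ k ∈ m.divisors, polyIterate f k - X ≠ 0) (Φ : R[X]) :
    IsDynatomicPolynomial f m Φ ↔ moebiusPart f m (-1) * Φ = moebiusPart f m 1 := by
  have hne : ∀ i, moebiusPart f m i ≠ 0 := fun i ↦
    Finset.prod_ne_zero_iff.2 fun k hk ↦ hf k (Finset.mem_filter.1 hk).1
  have hinj := IsFractionRing.injective R[X] (FractionRing R[X])
  have key : algebraMap R[X] (FractionRing R[X]) (moebiusPart f m (-1)) * dynatomicQuotient f m =
      algebraMap R[X] (FractionRing R[X]) (moebiusPart f m 1) := by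
    rw [moebiusPart, moebiusPart, dynatomicQuotient, map_prod, map_prod, Finset.prod_filter,
      Finset.prod_filter, ← Finset.prod_mul_distrib]
    refine Finset.prod_congr rfl fun k hk ↦ ?_
    have h0 : algebraMap R[X] (FractionRing R[X]) (polyIterate f k - X) ≠ 0 := by
      rw [Ne, map_eq_zero_iff _ hinj]; exact hf k hk
    rcases ArithmeticFunction.moebius_eq_or (m / k) with h | h | h <;>
      simp [h, h0, -map_sub]
  have h0 : algebraMap R[X] (FractionRing R[X]) (moebiusPart f m (-1)) ≠ 0 := by
    rw [Ne, map_eq_zero_iff _ hinj]; exact hne _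
  rw [IsDynatomicPolynomial, ← mul_right_inj' h0, key, ← map_mul, hinj.eq_iff]

variable {L : Type*} [Field L] [DecidableEq L] [IsAlgClosed L] {d : ℕ} {c : L}

theorem isDynatomicPolynomial_prod_perSet (hd : 0 < d)
    (hsep : ∀ k, 0 < k → ∀ z, Function.IsPeriodicPt (famMap d c) k z → famMultiplier d c k z ≠ 1)
    {m : ℕ} (hm : 0 < m) :
    IsDynatomicPolynomial (famPoly d c) m (∏ z ∈ perSet d c m, (X - C z)) := by
  have hinj := IsFractionRing.injective L[X] (FractionRing L[X])
  have h := (ArithmeticFunction.prod_eq_iff_prod_pow_moebius_eq_of_nonzero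
    (f := fun e ↦ algebraMap L[X] (FractionRing L[X]) (∏ z ∈ perSet d c e, (X - C z)))
    (g := fun k ↦ algebraMap L[X] (FractionRing L[X]) (polyIterate (famPoly d c) k - X))
    (fun n _ ↦ by
      rw [Ne, map_eq_zero_iff _ hinj]
      exact (monic_prod_of_monic _ _ fun z _ ↦ monic_X_sub_C z).ne_zero)
    (fun n hn ↦ by
      rw [Ne, map_eq_zero_iff _ hinj]
      exact (monic_polyIterate_sub_X hd c hn).1.ne_zero)).1
    (fun n hn ↦ by
      rw [polyIterate_sub_X_eq_prod hd hn (hsep n hn), prod_fixedSet hd hn, map_prod]) m hm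
  rw [IsDynatomicPolynomial, ← h, dynatomicQuotient,
    ← Nat.map_div_left_divisors, Finset.prod_map]
  rfl

theorem exists_isDynatomicPolynomial_fTilde [CharZero L] (hc : Transcendental ℤ c) (hd : 0 < d)
    (hsep : ∀ k, 0 < k → ∀ z, Function.IsPeriodicPt (famMap d c) k z → famMultiplier d c k z ≠ 1)
    {m : ℕ} (hm : 0 < m) :
    ∃ Φ : ℤ[X][X], IsDynatomicPolynomial (fTilde d) m Φ ∧
      Φ.map (aeval c : ℤ[X] →ₐ[ℤ] L).toRingHom = ∏ z ∈ perSet d c m, (X - C z) := by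
  set φ := (aeval c : ℤ[X] →ₐ[ℤ] L).toRingHom with hφ
  have hφi : Function.Injective φ := transcendental_iff_injective.1 hc
  have hmap : (fTilde d).map φ = famPoly d c := by
    rw [fTilde_eq_famPoly, famPoly_map]; simp [hφ]
  have hmon : ∀ i, (moebiusPart (fTilde d) m i).Monic := fun i ↦
    monic_prod_of_monic _ _ fun k hk ↦ (monic_polyIterate_sub_X hd _
      (Nat.pos_of_mem_divisors (Finset.mem_filter.1 hk).1)).1
  have h1 := (isDynatomicPolynomial_iff (fun k hk ↦ (monic_polyIterate_sub_X hd c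
    (Nat.pos_of_mem_divisors hk)).1.ne_zero) _).1 (isDynatomicPolynomial_prod_perSet hd hsep hm)
  rw [← hmap, ← moebiusPart_map, ← moebiusPart_map] at h1
  -- The divisor is monic, so divisibility over `L` descends to `ℤ[c]`.
  obtain ⟨Φ, hΦ⟩ := (Polynomial.map_dvd_map φ hφi (hmon (-1))).1 ⟨_, h1.symm⟩
  refine ⟨Φ, (isDynatomicPolynomial_iff (fun k hk ↦ (monic_polyIterate_sub_X hd (X : ℤ[X])
    (Nat.pos_of_mem_divisors hk)).1.ne_zero) _).2 hΦ.symm, ?_⟩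
  rw [hΦ, Polynomial.map_mul] at h1
  exact (mul_left_cancel₀ ((hmon (-1)).map φ).ne_zero h1).symm

end Dynatomic

theorem multiplierResultant_map {L : Type*} [Field L] {d : ℕ} {c : L} (hd : 0 < d) {m : ℕ} {Φ : ℤ[X][X]} {S : Finset L}
    (hc : Transcendental ℤ c)
    (hΦ : Φ.map (aeval c : ℤ[X] →ₐ[ℤ] L).toRingHom = ∏ z ∈ S, (X - C z)) :
    (multiplierResultant (fTilde d) m Φ).map (aeval c : ℤ[X] →ₐ[ℤ] L).toRingHom =
      ∏ z ∈ S, (X - C (famMultiplier d c m z)) := by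
  set φ := (aeval c : ℤ[X] →ₐ[ℤ] L).toRingHom with hφ
  have hφi : Function.Injective φ := transcendental_iff_injective.1 hc
  have hmap : (fTilde d).map φ = famPoly d c := by
    rw [fTilde_eq_famPoly, famPoly_map]; simp [hφ]
  have hcomm : ∀ p : ℤ[X][X], (p.map (C : ℤ[X] →+* ℤ[X][X])).map (mapRingHom φ) =
      (p.map φ).map (C : L →+* L[X]) := by
    intro p
    rw [Polynomial.map_map, Polynomial.map_map]
    congr 1
    ext <;> simp
  have hprod : (∏ z ∈ S, (X - C z)).map (C : L →+* L[X]) = ∏ z ∈ S, (X - C (C z)) := by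
    simp [Polynomial.map_prod]
  have hdeg : (Φ.map (C : ℤ[X] →+* ℤ[X][X])).natDegree =
      (∏ z ∈ S, (X - C (C z) : L[X][X])).natDegree := by
    rw [← hprod, ← hΦ, natDegree_map_eq_of_injective C_injective,
      natDegree_map_eq_of_injective C_injective, natDegree_map_eq_of_injective hφi]
  rw [← coe_mapRingHom, multiplierResultant, ← resultant_map_map, hcomm, hΦ, hprod, hdeg]
  -- The resultant keeps the formal degrees from before the mapping; for the second argument an
  -- inequality suffices, since the first is monic.
  have hle : ((C X - (derivative (polyIterate (fTilde d) m)).map C : ℤ[X][X][X]).map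
      (mapRingHom φ)).natDegree ≤
      (C X - (derivative (polyIterate (fTilde d) m)).map C : ℤ[X][X][X]).natDegree :=
    natDegree_map_le
  rw [resultant_prod_left _ _ _ _ (by simp) hle]
  refine Finset.prod_congr rfl fun z _ ↦ ?_
  rw [natDegree_X_sub_C, resultant_X_sub_C_left _ _ _ hle, Polynomial.map_sub, hcomm,
    ← derivative_map, polyIterate_map, hmap, eval_sub, ← eval_derivative_polyIterate hd,
    eval_map_apply]
  simp

/-! ### Descent of monic roots to the base ring. -/

section Descent

theorem Polynomial.Monic.eq_of_pow_eq_pow {R : Type*} [CommRing R] [IsDomain R]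
    [IsIntegrallyClosed R[X]] {p q : R[X]} (hp : p.Monic)
    (hq : q.Monic) {m : ℕ} (hm : m ≠ 0) (h : p ^ m = q ^ m) : p = q :=
  eq_of_monic_of_associated hp hq
    (associated_of_dvd_dvd ((IsIntegrallyClosed.pow_dvd_pow_iff hm).1 h.dvd)
      ((IsIntegrallyClosed.pow_dvd_pow_iff hm).1 h.symm.dvd))

/-- A monic polynomial over a Galois extension of the fraction field of an integrally closed
domain `A` has coefficients in `A` if one of its powers has. -/
theorem exists_monic_map_eq_of_pow_eq {A : Type*} (K : Type*) {L : Type*} [CommRing A] [IsDomain A]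
    [IsIntegrallyClosed A] [Field K] [Field L] [Algebra A K] [IsFractionRing A K] [Algebra K L]
    [Algebra A L] [IsScalarTower A K L] [IsGalois K L] {p : A[X]} {q : L[X]} (hq : q.Monic)
    {m : ℕ} (hm : m ≠ 0) (h : q ^ m = p.map (algebraMap A L)) :
    ∃ q' : A[X], q'.Monic ∧ q'.map (algebraMap A L) = q := by
  have hAK := IsFractionRing.injective A K
  have hAL : Function.Injective (algebraMap A L) := by
    rw [IsScalarTower.algebraMap_eq A K L]
    exact (algebraMap K L).injective.comp hAK
  have hp : p.Monic := monic_of_injective hAL (h ▸ hq.pow m)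
  -- Monic `m`-th roots are unique, so `q` is Galois-invariant.
  have hfix : ∀ σ : L ≃ₐ[K] L, q.map (σ : L →+* L) = q := by
    intro σ
    refine (hq.map _).eq_of_pow_eq_pow hq hm ?_
    rw [← Polynomial.map_pow, h, Polynomial.map_map]
    congr 1
    ext a
    simp [IsScalarTower.algebraMap_apply A K L]
  obtain ⟨r, hr⟩ : q ∈ lifts (algebraMap K L) := by
    rw [lifts_iff_coeff_lifts]
    intro n
    rw [InfiniteGalois.mem_range_algebraMap_iff_fixed]
    intro σ
    conv_rhs => rw [← hfix σ, coeff_map]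
    rfl
  rw [coe_mapRingHom] at hr
  have hrm : r.Monic := monic_of_injective (algebraMap K L).injective (hr ▸ hq)
  have hrp : r ^ m = p.map (algebraMap A K) := by
    refine map_injective _ (algebraMap K L).injective ?_
    rw [Polynomial.map_pow, hr, h, Polynomial.map_map, ← IsScalarTower.algebraMap_eq]
  -- Gauss's lemma: a monic factor over `K` of a monic polynomial over `A` lies over `A`.
  obtain ⟨q', hq'⟩ := IsIntegrallyClosed.eq_map_mul_C_of_dvd K hp
    (show r ∣ p.map (algebraMap A K) from hrp ▸ dvd_pow_self r hm)
  rw [hrm.leadingCoeff, C_1, mul_one] at hq'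
  refine ⟨q', monic_of_injective hAK (hq' ▸ hrm), ?_⟩
  rw [IsScalarTower.algebraMap_eq A K L, ← Polynomial.map_map, hq', hr]

theorem exists_ringHom_extending {A : Type*} (K : Type*) {L M : Type*} [CommRing A] [IsDomain A]
    [Field K] [Field L] [Field M] [Algebra A K] [IsFractionRing A K] [Algebra K L] [Algebra A L]
    [IsScalarTower A K L] [Algebra.IsAlgebraic K L] [IsAlgClosed M] (φ : A →+* M)
    (hφ : Function.Injective φ) : ∃ τ : L →+* M, ∀ a, τ (algebraMap A L a) = φ a := by
  let κ : K →+* M := IsFractionRing.lift (A := A) hφ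
  let _ := κ.toAlgebra
  refine ⟨(IsAlgClosed.lift : L →ₐ[K] M).toRingHom, fun a ↦ ?_⟩
  rw [IsScalarTower.algebraMap_apply A K L]
  refine ((IsAlgClosed.lift : L →ₐ[K] M).commutes _).trans ?_
  exact IsFractionRing.lift_algebraMap hφ a

end Descent

/-! ### The symmetry `c ↦ ωc`. -/

section Symmetry

variable {L : Type*} [Field L] {d : ℕ} {c ω : L} {τ : L →+* L}

/-- For `ω^d = 1` the family satisfies `f_{ωc}(ωy) = ω f_c(y)`. -/
theorem famMap_twist (hω : ω ^ d = 1) (hω0 : ω ≠ 0) (hτ : τ c = ω * c) (z : L) :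
    famMap d c (ω⁻¹ * τ z) = ω⁻¹ * τ (famMap d c z) := by
  have h : τ z = ω * (ω⁻¹ * τ z) := by field_simp
  simp only [famMap, map_add, map_mul, map_sub, map_pow, hτ]
  generalize ω⁻¹ * τ z = y at *
  rw [h, mul_pow, hω]
  field_simp

theorem iterate_famMap_twist (hω : ω ^ d = 1) (hω0 : ω ≠ 0) (hτ : τ c = ω * c) (z : L) (k : ℕ) :
    (famMap d c)^[k] (ω⁻¹ * τ z) = ω⁻¹ * τ ((famMap d c)^[k] z) := by
  induction k with
  | zero => rfl
  | succ k ih =>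
    rw [Function.iterate_succ_apply', Function.iterate_succ_apply', ih, famMap_twist hω hω0 hτ]

theorem famDeriv_twist (hd : 0 < d) (hω : ω ^ d = 1) (hω0 : ω ≠ 0) (hτ : τ c = ω * c) (z : L) :
    famDeriv d c (ω⁻¹ * τ z) = τ (famDeriv d c z) := by
  have h : τ z = ω * (ω⁻¹ * τ z) := by field_simp
  simp only [famDeriv, map_add, map_mul, map_sub, map_pow, map_one, map_natCast, hτ]
  generalize ω⁻¹ * τ z = y at *
  rw [h, mul_pow]
  have h2 : ω ^ (d - 1) * ω = 1 := by rw [← pow_succ, Nat.sub_add_cancel hd, hω]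
  linear_combination (-(y ^ (d - 1) * ((d + 1) * y - d * c))) * h2

theorem famMultiplier_twist (hd : 0 < d) (hω : ω ^ d = 1) (hω0 : ω ≠ 0) (hτ : τ c = ω * c) (z : L)
    (m : ℕ) : famMultiplier d c m (ω⁻¹ * τ z) = τ (famMultiplier d c m z) := by
  simp only [famMultiplier, iterate_famMap_twist hω hω0 hτ, famDeriv_twist hd hω hω0 hτ, map_prod]

theorem map_prod_X_sub_C_famMultiplier [DecidableEq L] (hd : 0 < d) (hω : ω ^ d = 1)
    (hτ : τ c = ω * c) {m : ℕ} (hm : 0 < m) :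
    (∏ z ∈ perSet d c m, (X - C (famMultiplier d c m z))).map τ =
      ∏ z ∈ perSet d c m, (X - C (famMultiplier d c m z)) := by
  have hω0 : ω ≠ 0 := by
    rintro rfl
    rw [zero_pow hd.ne'] at hω
    exact zero_ne_one hω
  have hinj : Function.Injective fun z : L ↦ ω⁻¹ * τ z := fun a b h ↦
    τ.injective (mul_left_cancel₀ (inv_ne_zero hω0) h)
  have himg : (perSet d c m).image (fun z ↦ ω⁻¹ * τ z) = perSet d c m := by
    refine Finset.eq_of_subset_of_card_le ?_ (Finset.card_image_of_injective _ hinj).ge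
    intro y hy
    obtain ⟨z, hz, rfl⟩ := Finset.mem_image.1 hy
    rw [mem_perSet hd hm] at hz ⊢
    rw [← hz, Function.minimalPeriod_eq_minimalPeriod_iff]
    intro n
    simp only [Function.IsPeriodicPt, Function.IsFixedPt]
    rw [iterate_famMap_twist hω hω0 hτ]
    exact hinj.eq_iff
  conv_rhs => rw [← himg, Finset.prod_image hinj.injOn]
  simp [Polynomial.map_prod, famMultiplier_twist hd hω hω0 hτ]

/-- Averaging over the `d`-th roots of unity kills the monomials of degree not divisible by `d` and
keeps the others. -/
theorem eq_expand_contract_of_aeval_eq [CharZero L] [IsAlgClosed L] (hc : Transcendental ℤ c)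
    (hd : 0 < d) {a : ℤ[X]} (h : ∀ ω : L, ω ^ d = 1 → aeval (ω * c) a = aeval c a) :
    a = expand ℤ d (contract d a) := by
  have hd0 : (d : L) ≠ 0 := by exact_mod_cast hd.ne'
  have : NeZero (d : L) := ⟨hd0⟩
  obtain ⟨ζ, hζ⟩ := HasEnoughRootsOfUnity.exists_primitiveRoot L d
  have hζd : ζ ^ d = 1 := hζ.pow_eq_one
  have key : ∀ b : ℤ[X], ∑ i ∈ Finset.range d, aeval (ζ ^ i * c) b =
      d * aeval c (expand ℤ d (contract d b)) := by
    intro b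
    induction b using Polynomial.induction_on' with
    | add p q hp hq =>
      simp only [map_add, Finset.sum_add_distrib, hp, hq, contract_add hd.ne', mul_add]
    | monomial n r =>
      have h1 : ∑ i ∈ Finset.range d, (ζ ^ i) ^ n = if d ∣ n then (d : L) else 0 := by
        simp_rw [← pow_mul, mul_comm _ n, pow_mul]
        split_ifs with hn
        · rw [(hζ.pow_eq_one_iff_dvd n).2 hn]; simp
        · have h2 : ζ ^ n - 1 ≠ 0 := sub_ne_zero.2 fun h ↦ hn ((hζ.pow_eq_one_iff_dvd n).1 h)
          refine mul_left_cancel₀ h2 ?_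
          rw [mul_geom_sum, ← pow_mul, mul_comm, pow_mul, hζd]; simp
      have h3 : expand ℤ d (contract d (monomial n r)) = if d ∣ n then monomial n r else 0 := by
        ext j
        rw [coeff_expand hd, coeff_contract hd.ne']
        by_cases hj : d ∣ j
        · rw [if_pos hj, Nat.div_mul_cancel hj, coeff_monomial]
          split_ifs with h4 h5 h5 <;> simp_all [coeff_monomial]
        · rw [if_neg hj]
          split_ifs with h4
          · rw [coeff_monomial, if_neg (by rintro rfl; exact hj h4)]
          · simp
      simp only [aeval_monomial, mul_pow]
      rw [← Finset.mul_sum, ← Finset.sum_mul, h1, h3]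
      split_ifs
      · rw [aeval_monomial]; ring
      · simp
  have h1 := key a
  rw [Finset.sum_congr rfl fun i _ ↦ h (ζ ^ i) (by rw [← pow_mul, mul_comm, pow_mul, hζd, one_pow])]
    at h1
  rw [Finset.sum_const, Finset.card_range, nsmul_eq_mul] at h1
  exact transcendental_iff_injective.1 hc (mul_left_cancel₀ hd0 h1)

end Symmetry

/-! ### The normalizing power of `d`, period by period. -/

section Normalization

variable {L : Type} [Field L] [DecidableEq L] [CharZero L] [IsAlgClosed L] {d : ℕ} {c : L}

variable (d c) in
/-- The product of the derivative over the points of exact period `e`, scaled by the power of `d`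
that makes it a polynomial in `d c`. -/
noncomputable def scaledDerivProd (e : ℕ) : L :=
  d ^ ((d - 1) * epsilonOne e + (perSet d c e).card / (d + 1)) * ∏ z ∈ perSet d c e, famDeriv d c z

/-- Over the divisors of `k` the exponents of `d` add up to `d - 1 + (d+1)^(k-1)`: only `e = 1`
contributes `d - 1`, and the counts sum to `(d+1)^k`. -/
theorem exists_aeval_eq_prod_scaledDerivProd (hd : 0 < d)
    (hsep : ∀ k, 0 < k → ∀ z, Function.IsPeriodicPt (famMap d c) k z → famMultiplier d c k z ≠ 1)
    {k : ℕ} (hk : 0 < k) :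
    ∃ g : ℤ[X], IsUnit g.leadingCoeff ∧
      aeval (d * c) g = ∏ e ∈ k.divisors, scaledDerivProd d c e := by
  obtain ⟨g, hu, hg⟩ := exists_aeval_eq_prod_famDeriv hd c hk (hsep k hk)
  refine ⟨g, hu, hg.trans ?_⟩
  simp only [scaledDerivProd]
  rw [Finset.prod_mul_distrib, ← prod_fixedSet hd hk, Finset.prod_pow_eq_pow_sum]
  congr 2
  rw [Finset.sum_add_distrib, ← Finset.mul_sum]
  congr 1
  · simp [epsilonOne, hk.ne']
  · rw [← Nat.sum_div fun e he ↦ dvd_card_perSet hd (Nat.pos_of_mem_divisors he) hsep,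
      sum_card_perSet hd hk (hsep k hk)]
    obtain ⟨j, rfl⟩ : ∃ j, k = j + 1 := ⟨k - 1, by omega⟩
    rw [pow_succ, Nat.mul_div_cancel _ (Nat.succ_pos d), Nat.add_sub_cancel]

/-- A function on the positive integers whose products over divisors all equal `1` is `1`. -/
theorem eq_one_of_prod_divisors_eq_one {M : Type*} [CommMonoid M] {y : ℕ → M}
    (h : ∀ k, 0 < k → ∏ e ∈ k.divisors, y e = 1) {k : ℕ} (hk : 0 < k) : y k = 1 := by
  induction k using Nat.strong_induction_on with
  | _ k ih =>
    have h1 := h k hk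
    rwa [← Nat.insert_self_properDivisors hk.ne', Finset.prod_insert Nat.self_notMem_properDivisors,
      Finset.prod_eq_one fun e he ↦ ih e (Nat.mem_properDivisors.1 he).2
        (Nat.pos_of_mem_properDivisors he), mul_one] at h1

end Normalization

theorem famMultiplier_apply {R : Type*} [CommRing R] {d : ℕ} {c z : R} {m : ℕ}
    (hz : Function.IsPeriodicPt (famMap d c) m z) :
    famMultiplier d c m (famMap d c z) = famMultiplier d c m z := by
  rcases m with _ | n
  · simp [famMultiplier]
  · simp_rw [famMultiplier, ← Function.iterate_succ_apply]
    rw [Finset.prod_range_succ, Finset.prod_range_succ' (fun i ↦ famDeriv d c ((famMap d c)^[i] z)),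
      hz.eq]
    rfl

theorem exists_multiplierPolynomial_factorization {L : Type} [Field L] [DecidableEq L]
    {d : ℕ} {c : L} (hd : 0 < d) {m : ℕ} (hm : 0 < m) :
    ∃ T ⊆ perSet d c m,
      (∏ z ∈ perSet d c m, (X - C (famMultiplier d c m z)) =
        (∏ z ∈ T, (X - C (famMultiplier d c m z))) ^ m) ∧
      ∏ z ∈ perSet d c m, famDeriv d c z = ∏ z ∈ T, famMultiplier d c m z := by
  have hper : ∀ z ∈ perSet d c m, Function.minimalPeriod (famMap d c) z = m := fun z hz ↦
    (mem_perSet hd hm).1 hz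
  have hpt : ∀ z ∈ perSet d c m, (famMap d c)^[m] z = z := fun z hz ↦ by
    have := Function.isPeriodicPt_minimalPeriod (famMap d c) z
    rwa [hper z hz] at this
  -- One set of representatives serves both products, as `h` applies in `L[X]` and in `L`.
  obtain ⟨T, hT, h⟩ := exists_orbit_representatives (famMap d c) hm (perSet d c m)
    (fun z hz ↦ by
      rw [mem_perSet hd hm] at hz ⊢
      rw [Function.minimalPeriod_apply, hz]
      exact Function.minimalPeriod_pos_iff_mem_periodicPts.1 (hz ▸ hm)) hper
  refine ⟨T, hT, ?_, h _⟩
  rw [h, ← Finset.prod_pow]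
  refine Finset.prod_congr rfl fun z hz ↦ ?_
  rw [← Finset.card_range m, ← Finset.prod_const, Finset.card_range]
  refine Finset.prod_congr rfl fun i _ ↦ ?_
  congr 2
  clear * - hpt hT hz
  induction i with
  | zero => rfl
  | succ i ih =>
    rw [Function.iterate_succ_apply', famMultiplier_apply ?_, ← ih]
    exact (show Function.IsPeriodicPt (famMap d c) m z from hpt z (hT hz)).apply_iterate i

/-! ### Integrality of the scaled coefficients. -/

section Integrality

theorem exists_pow_mul_aeval_eq {L : Type*} [Field L] (d : ℕ) (c : L) (a : ℤ[X]) :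
    ∃ (n : ℕ) (b : ℤ[X]), ((d ^ n : ℕ) : L) * aeval c a = aeval (d * c) b := by
  induction a using Polynomial.induction_on' with
  | add p q hp hq =>
    obtain ⟨n, b, hb⟩ := hp
    obtain ⟨k, b', hb'⟩ := hq
    refine ⟨n + k, (d : ℤ[X]) ^ k * b + (d : ℤ[X]) ^ n * b', ?_⟩
    simp only [map_add, map_mul, map_pow, map_natCast, ← hb, ← hb']
    push_cast
    ring
  | monomial k r =>
    refine ⟨k, monomial k r, ?_⟩
    simp only [aeval_monomial]
    push_cast
    ring

theorem famMultiplier_ne_one {L : Type*} [Field L] {d : ℕ} {c : L} (hc : Transcendental ℤ c) (hd : 0 < d) (k : ℕ) (hk : 0 < k) (z : L)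
    (hz : Function.IsPeriodicPt (famMap d c) k z) : famMultiplier d c k z ≠ 1 := by
  obtain ⟨V, hV, hVc⟩ := exists_valuation_infinity hc
  intro h
  have := one_lt_valuation_famMultiplier hV hVc hd hk hz
  rw [h, map_one] at this
  exact lt_irrefl _ this

variable {L : Type} [Field L] [DecidableEq L] [CharZero L] [IsAlgClosed L] {d : ℕ} {c : L}

theorem valuation_scaledDerivProd (hc : Transcendental ℤ c) (hd : 0 < d) {p : ℕ} (hp : p.Prime)
    {V : ValuationSubring L} (hV : ∀ a : ℤ[X], V.valuation (aeval (d * c) a) ≤ 1 ∧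
      (V.valuation (aeval (d * c) a) < 1 ↔ C (p : ℤ) ∣ a)) {m : ℕ} (hm : 0 < m) :
    V.valuation (scaledDerivProd d c m) = 1 := by
  refine eq_one_of_prod_divisors_eq_one (y := fun e ↦ V.valuation (scaledDerivProd d c e))
    (fun k hk ↦ ?_) hm
  obtain ⟨g, hu, hg⟩ := exists_aeval_eq_prod_scaledDerivProd hd (famMultiplier_ne_one hc hd) hk
  rw [← map_prod, ← hg]
  exact le_antisymm (hV g).1
    (not_lt.1 fun h ↦ not_C_dvd_of_isUnit_leadingCoeff hp hu ((hV g).2.1 h))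

/-- Elements of `ℤ[c]` have only powers of `d` as denominators over `ℤ[dc]`, so the primes `p ∣ d`
suffice; `scaledDerivProd` is a yardstick of valuation `1` there. -/
theorem exists_aeval_eq_of_valuation_le (hc : Transcendental ℤ c) (hd : 0 < d) {m : ℕ} (hm : 0 < m)
    (N : ℕ) (a : ℤ[X])
    (h : ∀ (p : ℕ) (V : ValuationSubring L), p.Prime → p ∣ d →
      (∀ a : ℤ[X], V.valuation (aeval (d * c) a) ≤ 1 ∧
        (V.valuation (aeval (d * c) a) < 1 ↔ C (p : ℤ) ∣ a)) →
      V.valuation (d ^ N * aeval c a) ≤ V.valuation (scaledDerivProd d c m)) :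
    ∃ b : ℤ[X], aeval (d * c) b = d ^ N * aeval c a := by
  obtain ⟨n, b, hb⟩ := exists_pow_mul_aeval_eq d c a
  obtain ⟨b', hb'⟩ := exists_eq_aeval_of_valuation_le_one (t := (d : L) * c)
    (y := d ^ N * aeval c a) (D := d ^ n) (pow_ne_zero _ hd.ne') (fun p hp hpd ↦ by
      obtain ⟨V, hV⟩ := exists_valuation_prime (transcendental_natCast_mul hc hd) hp
      refine ⟨V, fun k ↦ by simpa only [aeval_C, map_natCast] using (hV (C (k : ℤ))).1, ?_, fun a ↦ (hV a).2.1,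
        (h p V hp (hp.dvd_of_dvd_pow hpd) hV).trans (valuation_scaledDerivProd hc hd hp hV hm).le⟩
      simpa only [aeval_C, map_natCast] using (hV (C (p : ℤ))).2.2 dvd_rfl)
    (b := (d : ℤ[X]) ^ N * b) (by
      rw [map_mul, ← hb, map_pow, map_natCast]; ring)
  exact ⟨b', hb'.symm⟩

theorem exists_aeval_eq_scaledDerivProd (hc : Transcendental ℤ c) (hd : 0 < d)
    (hdesc : ∀ e, 0 < e → ∃ a : ℤ[X], aeval c a = ∏ z ∈ perSet d c e, famDeriv d c z) {m : ℕ}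
    (hm : 0 < m) :
    ∃ b : ℤ[X], IsUnit b.leadingCoeff ∧ aeval (d * c) b = scaledDerivProd d c m := by
  have h : ∀ e : ℕ, ∃ b : ℤ[X], 0 < e → aeval (d * c) b = scaledDerivProd d c e := by
    intro e
    rcases Nat.eq_zero_or_pos e with rfl | he
    · exact ⟨0, fun h ↦ absurd h (lt_irrefl _)⟩
    obtain ⟨a, ha⟩ := hdesc e he
    obtain ⟨b, hb⟩ := exists_aeval_eq_of_valuation_le hc hd he
      ((d - 1) * epsilonOne e + (perSet d c e).card / (d + 1)) a
      (fun p V _ _ _ ↦ by rw [ha, scaledDerivProd])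
    exact ⟨b, fun _ ↦ by rw [hb, ha, scaledDerivProd]⟩
  choose b hb using h
  refine ⟨b m, ?_, hb m hm⟩
  obtain ⟨g, hu, hg⟩ := exists_aeval_eq_prod_scaledDerivProd hd (famMultiplier_ne_one hc hd) hm
  rw [← Finset.prod_congr rfl fun e he ↦ hb e (Nat.pos_of_mem_divisors he), ← map_prod] at hg
  have hgb := transcendental_iff_injective.1 (transcendental_natCast_mul hc hd) hg
  rw [hgb, leadingCoeff_prod] at hu
  -- The leading coefficients of the `b e`, `e ∣ m`, multiply to a unit, so each is a unit.
  exact isUnit_of_dvd_unit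
    (Finset.dvd_prod_of_mem (fun e ↦ (b e).leadingCoeff) (Nat.mem_divisors_self m hm.ne')) hu

/-- The coefficients of the scaled multiplier polynomial are polynomials in `d c`, and the constant
one dominates. -/
theorem exists_scaled_coefficients (hc : Transcendental ℤ c) (hd : 0 < d)
    (hdesc : ∀ e, 0 < e → ∃ a : ℤ[X], aeval c a = ∏ z ∈ perSet d c e, famDeriv d c z) {m : ℕ}
    (hm : 0 < m) {T : Finset L} (hT : T ⊆ perSet d c m)
    (hprod : ∏ z ∈ perSet d c m, famDeriv d c z = ∏ z ∈ T, famMultiplier d c m z) {δ : ℤ[X][X]}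
    (hδ : δ.map (aeval c : ℤ[X] →ₐ[ℤ] L).toRingHom = ∏ z ∈ T, (X - C (famMultiplier d c m z))) :
    ∃ b : ℕ → ℤ[X], (∀ j, aeval (d * c) (b j) =
        d ^ ((d - 1) * epsilonOne m + (perSet d c m).card / (d + 1)) * aeval c (δ.coeff j)) ∧
      IsUnit (b 0).leadingCoeff ∧
      ∀ j, 0 < j → b j = 0 ∨ (b j).natDegree < (b 0).natDegree := by
  set N := (d - 1) * epsilonOne m + (perSet d c m).card / (d + 1) with hN
  have hperT : ∀ z ∈ T, Function.IsPeriodicPt (famMap d c) m z := fun z hz ↦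
    (mem_fixedSet hd hm).1 (Finset.mem_filter.1 (hT hz)).1
  have hcoeff : ∀ j, aeval c (δ.coeff j) = (∏ z ∈ T, (X - C (famMultiplier d c m z))).coeff j := by
    intro j
    rw [← hδ, coeff_map]; rfl
  have hcoeff0 : aeval c (δ.coeff 0) = (-1) ^ T.card * ∏ z ∈ perSet d c m, famDeriv d c z := by
    rw [hcoeff, coeff_zero_eq_eval_zero, eval_prod, hprod]
    simp [Finset.prod_neg]
  have h0 : d ^ N * aeval c (δ.coeff 0) = (-1) ^ T.card * scaledDerivProd d c m := by
    rw [hcoeff0, scaledDerivProd]; ring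
  have hv0 : ∀ V : ValuationSubring L,
      V.valuation (d ^ N * aeval c (δ.coeff 0)) = V.valuation (scaledDerivProd d c m) := by
    intro V
    rw [h0, map_mul, map_pow, Valuation.map_neg, map_one, one_pow, one_mul]
  have hex : ∀ j, ∃ b : ℤ[X], aeval (d * c) b = d ^ N * aeval c (δ.coeff j) := by
    intro j
    refine exists_aeval_eq_of_valuation_le hc hd hm N _ fun p V hp hpd hV ↦ ?_
    rw [← hv0, map_mul, map_mul, hcoeff, hcoeff]
    exact mul_le_mul_of_nonneg_left (valuation_coeff_prod_le _ T _ (fun z hz ↦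
      one_le_valuation_famMultiplier hp hpd hV hd hm (hperT z hz)) j) zero_le
  choose b hb using hex
  have htinj := transcendental_iff_injective.1 (transcendental_natCast_mul hc hd)
  have hb0 : IsUnit (b 0).leadingCoeff := by
    obtain ⟨g, hu, hg⟩ := exists_aeval_eq_scaledDerivProd hc hd hdesc hm
    have h1 : b 0 = C ((-1) ^ T.card) * g := htinj (by
      rw [hb, h0, map_mul, hg]; simp)
    rw [h1, leadingCoeff_mul, leadingCoeff_C]
    exact (isUnit_one.neg.pow _).mul hu
  refine ⟨b, hb, hb0, fun j hj ↦ or_iff_not_imp_left.2 fun hbj ↦ ?_⟩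
  -- At infinity the valuation of a polynomial in `dc` records its degree, so strict dominance of
  -- the constant coefficient is a strict inequality of degrees.
  obtain ⟨V, hV, hVc⟩ := exists_valuation_infinity hc
  have hvd : V.valuation (d : L) = 1 := by simpa using hV d (by exact_mod_cast hd.ne')
  have hvt : 1 < V.valuation (d * c) := by rwa [map_mul, hvd, one_mul]
  have hlt : V.valuation (aeval (d * c) (b j)) < V.valuation (aeval (d * c) (b 0)) := by
    rw [hb, hb, map_mul, map_mul, map_pow, hvd, one_pow, one_mul, one_mul, hcoeff, hcoeff]
    exact valuation_coeff_prod_lt _ T _ (fun z hz ↦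
      one_lt_valuation_famMultiplier hV hVc hd hm (hperT z hz)) hj
  rw [valuation_aeval_eq_pow _ hV hvt hbj, valuation_aeval_eq_pow _ hV hvt
    (leadingCoeff_ne_zero.1 hb0.ne_zero)] at hlt
  exact (pow_lt_pow_iff_right₀ hvt).1 hlt

end Integrality

/-! ### Exchanging the two variables. -/

section Swap

theorem coeff_coeff_swap {R : Type*} [CommRing R] (p : R[X][X]) (i j : ℕ) :
    ((Bivariate.swap p).coeff i).coeff j = (p.coeff j).coeff i := by
  induction p using Polynomial.induction_on' with
  | add p q hp hq => simp [hp, hq]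
  | monomial n a =>
    induction a using Polynomial.induction_on' with
    | add p q hp hq => rw [map_add, map_add]; simp only [coeff_add, hp, hq]
    | monomial k r =>
      rw [Bivariate.swap_monomial_monomial]
      simp only [coeff_monomial]
      split_ifs <;> simp_all [coeff_monomial]

theorem evalAtScaledPower_swap (d : ℕ) (Θ : ℤ[X][X]) :
    evalAtScaledPower d (Bivariate.swap Θ) =
      Θ.map (aeval (((d : ℤ[X]) * X) ^ d) : ℤ[X] →ₐ[ℤ] ℤ[X]).toRingHom := by
  have h : (eval₂RingHom (mapRingHom (C : ℤ →+* ℤ[X])) (C (((d : ℤ[X]) * X) ^ d))).comp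
      (Bivariate.swap (R := ℤ) : ℤ[X][X] →+* ℤ[X][X]) =
      mapRingHom (aeval (((d : ℤ[X]) * X) ^ d) : ℤ[X] →ₐ[ℤ] ℤ[X]).toRingHom := by
    ext <;> simp [Bivariate.swap_X, Bivariate.swap_Y]
  exact RingHom.congr_fun h Θ

end Swap

/-! ### Assembling `Ψ` from the coefficients. -/

section Assembly

theorem eq_one_or_eq_neg_one_of_isUnit {a : ℤ[X]} (ha : IsUnit a) : a = 1 ∨ a = -1 := by
  obtain ⟨r, hr, rfl⟩ := Polynomial.isUnit_iff.1 ha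
  rcases Int.isUnit_iff.1 hr with rfl | rfl <;> simp

/-- A family `b` of polynomials in `t^d` whose zeroth member has the largest degree and a unit as
leading coefficient assembles to a polynomial that is monic up to sign. -/
theorem exists_evalAtScaledPower_eq {d : ℕ} (hd : 0 < d) {b : ℕ → ℤ[X]}
    (hb0 : IsUnit (b 0).leadingCoeff)
    (hb : ∀ j, 0 < j → b j = 0 ∨ (b j).natDegree < (b 0).natDegree)
    (hexp : ∀ j, b j = expand ℤ d (contract d (b j))) {P : ℤ[X][X]}
    (hP : ∀ j, P.coeff j = aeval ((d : ℤ[X]) * X) (b j)) :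
    ∃ Ψ : ℤ[X][X], P = evalAtScaledPower d Ψ ∧ (Ψ.Monic ∨ (-Ψ).Monic) := by
  set M := P.natDegree with hM
  set β : ℕ → ℤ[X] := fun j ↦ contract d (b j) with hβ
  have hdeg : ∀ j, (b j).natDegree = (β j).natDegree * d := fun j ↦ by
    conv_lhs => rw [hexp j, natDegree_expand]
  have hbM : ∀ j, M < j → β j = 0 := by
    intro j hj
    have h1 := hP j
    rw [coeff_eq_zero_of_natDegree_lt hj] at h1
    have h3 : b j = 0 := by
      rw [← comp_C_mul_X_eq_zero_iff (r := (d : ℤ))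
        (mem_nonZeroDivisors_of_ne_zero (by exact_mod_cast hd.ne')), comp, h1, aeval_def]
      rfl
    simp only [hβ, h3]
    ext n
    rw [coeff_contract hd.ne', coeff_zero, coeff_zero]
  set Θ : ℤ[X][X] := ∑ j ∈ Finset.range (M + 1), monomial j (β j) with hΘ
  have hΘc : ∀ j, Θ.coeff j = β j := by
    intro j
    rw [hΘ, finsetSum_coeff]
    simp only [coeff_monomial]
    rw [Finset.sum_ite_eq' (Finset.range (M + 1)) j]
    split_ifs with h
    · rfl
    · exact (hbM j (by simpa using h)).symm
  refine ⟨Bivariate.swap Θ, ?_, ?_⟩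
  · rw [evalAtScaledPower_swap]
    ext1 j
    rw [coeff_map, hΘc, hP, hexp j]
    simp only [AlgHom.toRingHom_eq_coe, RingHom.coe_coe, expand_aeval, hβ]
  · have hcoeff : ∀ i j, ((Bivariate.swap Θ).coeff i).coeff j = (β j).coeff i := fun i j ↦ by
      rw [coeff_coeff_swap, hΘc]
    have hlt : ∀ j, 0 < j → β j = 0 ∨ (β j).natDegree < (β 0).natDegree := by
      intro j hj
      rcases hb j hj with h | h
      · left
        simp only [hβ, h]
        ext n
        rw [coeff_contract hd.ne', coeff_zero, coeff_zero]
      · right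
        rw [hdeg, hdeg] at h
        exact lt_of_mul_lt_mul_right h (Nat.zero_le d)
    set n := (β 0).natDegree with hn
    have hle : (Bivariate.swap Θ).natDegree ≤ n := by
      rw [natDegree_le_iff_coeff_eq_zero]
      intro i hi
      ext1 j
      rw [hcoeff, coeff_zero]
      rcases Nat.eq_zero_or_pos j with rfl | hj
      · exact coeff_eq_zero_of_natDegree_lt hi
      · rcases hlt j hj with h | h
        · rw [h, coeff_zero]
        · exact coeff_eq_zero_of_natDegree_lt (h.trans hi)
    -- Only `β 0` reaches degree `n`, so the top coefficient in `C` is constant in `x`.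
    have htop : (Bivariate.swap Θ).coeff n = C (β 0).leadingCoeff := by
      ext1 j
      rw [hcoeff, coeff_C]
      split_ifs with hj
      · rw [hj]; rfl
      · rcases hlt j (Nat.pos_of_ne_zero hj) with h | h
        · rw [h, coeff_zero]
        · exact coeff_eq_zero_of_natDegree_lt h
    have hlc : (β 0).leadingCoeff = (b 0).leadingCoeff := by
      conv_rhs => rw [hexp 0, leadingCoeff_expand hd]
    rw [hlc] at htop
    rcases Int.isUnit_iff.1 hb0 with h | h
    · left
      exact monic_of_natDegree_le_of_coeff_eq_one n hle (by rw [htop, h, C_1])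
    · right
      exact monic_of_natDegree_le_of_coeff_eq_one n (by rwa [natDegree_neg])
        (by rw [coeff_neg, htop, h]; simp)


end Assembly

/-! ### Invariance of the coefficients and the final argument. -/

section Descend

variable (K : Type) {L : Type} [Field K] [Field L] [CharZero L] [IsAlgClosed L] [Algebra ℤ[X] K]
  [IsFractionRing ℤ[X] K] [Algebra K L] [Algebra ℤ[X] L] [IsScalarTower ℤ[X] K L]

/-- Multiplier polynomials are invariant under `c ↦ ω c` for `d`-th roots of unity `ω`. -/
theorem aeval_mul_coeff_eq [Algebra.IsAlgebraic K L] [DecidableEq L] {c ω : L}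
    (hφ : (aeval c : ℤ[X] →ₐ[ℤ] L).toRingHom = algebraMap ℤ[X] L) (hc : Transcendental ℤ c)
    {d m : ℕ} (hd : 0 < d) (hm : 0 < m) {δ : ℤ[X][X]} (hδ : δ.Monic)
    (hδm : (δ.map (aeval c : ℤ[X] →ₐ[ℤ] L).toRingHom) ^ m =
      ∏ z ∈ perSet d c m, (X - C (famMultiplier d c m z))) {b : ℕ → ℤ[X]} {N : ℕ}
    (hb : ∀ j, aeval (d * c) (b j) = d ^ N * aeval c (δ.coeff j)) (hω : ω ^ d = 1) (j : ℕ) :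
    aeval (ω * (d * c)) (b j) = aeval (d * c) (b j) := by
  have hω0 : ω ≠ 0 := by
    rintro rfl
    rw [zero_pow hd.ne'] at hω
    exact zero_ne_one hω
  have htr : Transcendental ℤ (ω * c) := by
    intro h
    have h1 : IsAlgebraic ℤ ω⁻¹ := by
      refine IsAlgebraic.inv ⟨X ^ d - 1, (monic_X_pow_sub_C (1 : ℤ) hd.ne').ne_zero, by simp [hω]⟩
    exact hc (by simpa [hω0] using h1.mul h)
  -- As `ωc` is transcendental, `c ↦ ωc` extends to an endomorphism of `L`.
  obtain ⟨τ, hτ⟩ := exists_ringHom_extending (A := ℤ[X]) K (L := L)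
    (aeval (ω * c) : ℤ[X] →ₐ[ℤ] L).toRingHom (transcendental_iff_injective.1 htr)
  have hτc : τ c = ω * c := by
    have h1 := hτ X
    rw [← hφ] at h1
    simpa using h1
  have hδτ : (δ.map (aeval c : ℤ[X] →ₐ[ℤ] L).toRingHom).map τ =
      δ.map (aeval c : ℤ[X] →ₐ[ℤ] L).toRingHom := by
    refine ((hδ.map _).map τ).eq_of_pow_eq_pow (hδ.map _) hm.ne' ?_
    rw [← Polynomial.map_pow, hδm, map_prod_X_sub_C_famMultiplier hd hω hτc hm]
  have h1 : τ (aeval c (δ.coeff j)) = aeval c (δ.coeff j) := by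
    have := congrArg (fun p ↦ coeff p j) hδτ
    simpa only [coeff_map] using! this
  have h2 : τ (aeval (d * c) (b j)) = aeval (ω * (d * c)) (b j) := by
    have h3 : τ (d * c) = ω * (d * c) := by rw [map_mul, map_natCast, hτc]; ring
    rw [← h3, aeval_def, aeval_def, hom_eval₂]
    congr 1
    exact RingHom.ext_int _ _
  rw [← h2, hb, map_mul, map_pow, map_natCast, h1]

theorem exists_scaled_multiplierPolynomial [IsGalois K L] {c : L}
    (hφ : (aeval c : ℤ[X] →ₐ[ℤ] L).toRingHom = algebraMap ℤ[X] L) {d m : ℕ} (hd : 0 < d) (hm : 0 < m) :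
    ∃ Φ : ℤ[X][X], IsDynatomicPolynomial (fTilde d) m Φ ∧
      (d + 1) ∣ Φ.natDegree ∧
      (∃ δ : ℤ[X][X], δ.Monic ∧ IsMultiplierPolynomial (fTilde d) m Φ δ) ∧
      ∀ δ : ℤ[X][X], IsMultiplierPolynomial (fTilde d) m Φ δ →
        ∃ Ψ : ℤ[X][X],
          (d : ℤ[X][X]) ^ ((d - 1) * epsilonOne m + Φ.natDegree / (d + 1)) * δ =
            evalAtScaledPower d Ψ ∧
          (Ψ.Monic ∨ (-Ψ).Monic) := by
  classical
  have hφ' : ∀ a : ℤ[X], aeval c a = algebraMap ℤ[X] L a := RingHom.congr_fun hφ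
  have hinj : Function.Injective (algebraMap ℤ[X] L) := by
    rw [IsScalarTower.algebraMap_eq ℤ[X] K L]
    exact (algebraMap K L).injective.comp (IsFractionRing.injective ℤ[X] K)
  have hc : Transcendental ℤ c := transcendental_iff_injective.2 fun a b h ↦
    hinj (by rwa [hφ', hφ'] at h)
  have hsep := famMultiplier_ne_one hc hd
  -- dynatomic polynomials, and multiplier polynomials descended from the algebraic closure
  have hΦ := fun e he ↦ exists_isDynatomicPolynomial_fTilde (m := e) hc hd hsep he
  have hδ : ∀ e, 0 < e → ∃ (T : Finset L) (δ : ℤ[X][X]), T ⊆ perSet d c e ∧ δ.Monic ∧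
      δ.map (aeval c : ℤ[X] →ₐ[ℤ] L).toRingHom = ∏ z ∈ T, (X - C (famMultiplier d c e z)) ∧
      (∏ z ∈ perSet d c e, (X - C (famMultiplier d c e z)) =
        (∏ z ∈ T, (X - C (famMultiplier d c e z))) ^ e) ∧
      ∏ z ∈ perSet d c e, famDeriv d c z = ∏ z ∈ T, famMultiplier d c e z := by
    intro e he
    obtain ⟨T, hT, hpow, hprod⟩ := exists_multiplierPolynomial_factorization (c := c) hd he
    obtain ⟨Φ, -, hΦm⟩ := hΦ e he
    obtain ⟨δ, hδ, hδT⟩ := exists_monic_map_eq_of_pow_eq (A := ℤ[X]) K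
      (p := multiplierResultant (fTilde d) e Φ)
      (monic_prod_of_monic T _ fun z _ ↦ monic_X_sub_C (famMultiplier d c e z)) he.ne'
      (by rw [← hpow, ← hφ, multiplierResultant_map hd hc hΦm])
    exact ⟨T, δ, hT, hδ, hφ ▸ hδT, hpow, hprod⟩
  have hdesc : ∀ e, 0 < e → ∃ a : ℤ[X], aeval c a = ∏ z ∈ perSet d c e, famDeriv d c z := by
    intro e he
    obtain ⟨T, δ, -, -, hδT, -, hprod⟩ := hδ e he
    refine ⟨(-1) ^ T.card * δ.coeff 0, ?_⟩
    have h1 : aeval c (δ.coeff 0) = (∏ z ∈ T, (X - C (famMultiplier d c e z))).coeff 0 := by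
      rw [← hδT, coeff_map]; rfl
    rw [map_mul, h1, coeff_zero_eq_eval_zero, eval_prod, hprod]
    simp only [eval_sub, eval_X, eval_C, zero_sub]
    rw [Finset.prod_neg, ← mul_assoc]
    simp [← mul_pow]
  obtain ⟨Φ, hdyn, hΦm⟩ := hΦ m hm
  obtain ⟨T, δ₀, hT, hδ₀, hδT, hpow, hprod⟩ := hδ m hm
  have hcard : Φ.natDegree = (perSet d c m).card := by
    rw [← natDegree_map_eq_of_injective (transcendental_iff_injective.1 hc : Function.Injective
      (aeval c : ℤ[X] →ₐ[ℤ] L).toRingHom), hΦm,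
      natDegree_prod_of_monic _ _ fun z _ ↦ monic_X_sub_C z]
    simp
  have hmult : IsMultiplierPolynomial (fTilde d) m Φ δ₀ := by
    refine map_injective _ hinj ?_
    rw [← hφ, multiplierResultant_map hd hc hΦm, Polynomial.map_pow, hδT, hpow]
  refine ⟨Φ, hdyn, hcard ▸ dvd_card_perSet hd hm hsep, ⟨δ₀, hδ₀, hmult⟩, ?_⟩
  obtain ⟨b, hb, hb0, hblt⟩ := exists_scaled_coefficients hc hd hdesc hm hT hprod hδT
  rw [← hcard] at hb
  set N := (d - 1) * epsilonOne m + Φ.natDegree / (d + 1) with hN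
  have hexp : ∀ j, b j = expand ℤ d (contract d (b j)) := fun j ↦
    eq_expand_contract_of_aeval_eq (transcendental_natCast_mul hc hd) hd fun ω hω ↦
      aeval_mul_coeff_eq K hφ hc hd hm hδ₀ (hδT ▸ hpow.symm) hb hω j
  obtain ⟨Ψ, hΨ, hΨm⟩ := exists_evalAtScaledPower_eq hd hb0 hblt hexp
    (P := (d : ℤ[X][X]) ^ N * δ₀) (fun j ↦ by
      have h1 : ((d : ℤ[X][X]) ^ N * δ₀).coeff j = (d : ℤ[X]) ^ N * δ₀.coeff j := by
        rw [← C_eq_natCast, ← C_pow, coeff_C_mul]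
      rw [h1]
      refine transcendental_iff_injective.1 hc ?_
      rw [map_mul, map_pow, map_natCast, ← hb, ← aeval_algHom_apply]
      simp)
  -- Any multiplier polynomial has leading coefficient `±1`, hence is `±δ₀`; the sign passes to `Ψ`.
  intro δ hδm
  have hpowδ : δ ^ m = δ₀ ^ m := hδm.trans hmult.symm
  have hlead : δ.leadingCoeff ^ m = 1 := by
    rw [← leadingCoeff_pow, hpowδ, leadingCoeff_pow, hδ₀.leadingCoeff, one_pow]
  rcases eq_one_or_eq_neg_one_of_isUnit (IsUnit.of_pow_eq_one hlead hm.ne') with h | h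
  · have : δ = δ₀ := Polynomial.Monic.eq_of_pow_eq_pow h hδ₀ hm.ne' hpowδ
    exact ⟨Ψ, this ▸ hΨ, hΨm⟩
  · have hmon : (-δ).Monic := by rw [Monic, leadingCoeff_neg, h, neg_neg]
    have hsign : ((-1 : ℤ[X][X])) ^ m = 1 := by
      rw [h] at hlead
      simpa using congrArg (C : ℤ[X] →+* ℤ[X][X]) hlead
    have : -δ = δ₀ := hmon.eq_of_pow_eq_pow hδ₀ hm.ne' (by
      rw [neg_pow, hsign, one_mul, hpowδ])
    refine ⟨-Ψ, ?_, by rwa [neg_neg, or_comm]⟩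
    rw [← this] at hΨ
    rw [evalAtScaledPower, eval₂_neg, ← evalAtScaledPower, ← hΨ]
    ring

end Descend

theorem mainTheorem11 (d m : ℕ) (hd : 0 < d) (hm : 0 < m) :
    ∃ Φ : ℤ[X][X], IsDynatomicPolynomial (fTilde d) m Φ ∧
      (d + 1) ∣ Φ.natDegree ∧
      (∃ δ : ℤ[X][X], δ.Monic ∧ IsMultiplierPolynomial (fTilde d) m Φ δ) ∧
      ∀ δ : ℤ[X][X], IsMultiplierPolynomial (fTilde d) m Φ δ →
        ∃ Ψ : ℤ[X][X],
          (d : ℤ[X][X]) ^ ((d - 1) * epsilonOne m + Φ.natDegree / (d + 1)) * δ =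
            evalAtScaledPower d Ψ ∧
          (Ψ.Monic ∨ (-Ψ).Monic) := by
  let K := FractionRing ℤ[X]
  have : CharZero K := charZero_of_injective_algebraMap (IsFractionRing.injective ℤ[X] K)
  have : CharZero (AlgebraicClosure K) :=
    charZero_of_injective_algebraMap (algebraMap K (AlgebraicClosure K)).injective
  exact exists_scaled_multiplierPolynomial K (L := AlgebraicClosure K)
    (c := algebraMap ℤ[X] (AlgebraicClosure K) X) (by ext <;> simp) hd hm
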